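/- **Theorem (uniform consistency of the MLE in the Thurstone–Mosteller model).** Fix an integer $T\ge 1$. For every $n$ let $p_n\in[0,1]$ and let $\mathbf u=\mathbf u^{(n)}\in\mathbb R^n$ be a score vector with $u_1=0$; let $M_n=\max_{i,j}|u_i-u_j|$. Let $\Phi(y)=\frac1{\sqrt{2\pi}}\int_{-\infty}^y e^{-x^2/2}\,dx$ and $f(1;y)=\Phi(y)$, $f(-1;y)=1-\Phi(y)$. The numbers of comparisons $n_{ij}\sim \mathrm{Bin}(T,p_n)$, $1\le i<j\le n$, are independent and, given them, the outcomes $X_{ij}^{(t)}\in\{-1,1\}$, $1\le t\le n_{ij}$, are independent with mass functions $f(\cdot\,;u_i-u_j)$ (the data for all $n$ live on one probability space, with an arbitrary dependence between different $n$). An MLE is a maximizer $\hat{\mathbf u}$ of $$l(\mathbf v)=\sum_{1\le i<j\le n}\ \sum_{1\le t\le n_{ij}}\log f(X^{(t)}_{ij};v_i-v_j)\quad\text{over } \{\mathbf v\in\mathbb R^n: v_1=0\}.$$ Put $$\rho_n=\sqrt{\frac{\log n}{np_n}}\;\frac{\log n}{\log (np_n)},\qquad \Delta_n=M_n e^{M_n^2}\rho_n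 .$$ There is a constant $C>0$ depending only on $T$ such that the following holds. Suppose that for some constant $c>1$ one has $p_n\ge c\,\frac{\log n}{n}$ for all large $n$, and that, as $n\to\infty$, $$\Delta_n\to0\quad\text{and}\quad \rho_n\to 0$$ (the second condition follows from the first when $M_n$ is bounded away from $0$). Then the MLE is uniformly consistent: 1. for all sufficiently large $n$, with probability at least $1-14n^{-2}$, the MLE $\hat{\mathbf u}$ exists, is unique, and satisfies $\|\hat{\mathbf u}-\mathbf u\|_\infty\le C(\Delta_n+\rho_n)$ (so $\|\hat{\mathbf u}-\mathbf u\|_\infty\lesssim\Delta_n$ when $M_n$ is bounded away from $0$); 2. almost surely, the MLE exists, is unique and satisfies this bound for all but finitely many $n$; 3. in particular, $\|\hat{\mathbf u}-\mathbf u\|_\infty\to0$ almost surely. -/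

import Mathlib

open MeasureTheory ProbabilityTheory Filter Topology

noncomputable section

namespace PairwiseComparison

/-- The standard normal distribution function (the probit link). -/
def probit (y : ℝ) : ℝ :=
  (1 / Real.sqrt (2 * Real.pi)) * ∫ x in Set.Iic y, Real.exp (-(x ^ 2) / 2)

/-- The Thurstone-Mosteller mass function on the outcome set `{-1, 1}` (and `0` elsewhere):
`f(1; y) = Φ(y)` and `f(-1; y) = 1 - Φ(y)`. -/
def tmMass (x : ℤ) (y : ℝ) : ℝ :=
  if x = 1 then probit y else if x = -1 then 1 - probit y else 0

/-- The law on `{-1, 1}` with mass function `f(·; y)`. -/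
def tmLaw (y : ℝ) : Measure ℤ :=
  ENNReal.ofReal (tmMass 1 y) • Measure.dirac 1 +
    ENNReal.ofReal (tmMass (-1) y) • Measure.dirac (-1)

/-- The unordered pairs of distinct subjects, represented as `(i, j)` with `i < j`. -/
abbrev Pair (n : ℕ) : Type := {e : Fin n × Fin n // e.1 < e.2}

/-- The relative score `v_i - v_j` of the pair `e = (i, j)`. -/
def relScore {n : ℕ} (v : Fin n → ℝ) (e : Pair n) : ℝ := v e.1.1 - v e.1.2

/-- The first subject is normalised to have score `0` (no condition if `n = 0`). -/
def FirstZero {n : ℕ} (v : Fin n → ℝ) : Prop := ∀ i : Fin n, (i : ℕ) = 0 → v i = 0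

/-- The dynamic range `max_{i,j} |u_i - u_j|`. -/
def dynamicRange {n : ℕ} (u : Fin n → ℝ) : ℝ := ⨆ e : Fin n × Fin n, |u e.1 - u e.2|

/-- Comparison data from the Thurstone-Mosteller model with scores `u`. The number of comparisons
`N e` of each pair `e = (i, j)` is `Bin(T, p)`; the outcome `X e t` of the `t`-th comparison
(counted from `0`) of `e` has law `f(·; u_i - u_j)`; all these variables are independent.
Only the outcomes `X e t` with `t < N e` are observed, so that, conditionally on the
numbers of comparisons, the observed outcomes are independent with laws `f(·; u_i - u_j)`. -/
structure IsTMData {Ω : Type*} [MeasurableSpace Ω] (μ : Measure Ω) (T : ℕ) (p : unitInterval)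
    {n : ℕ} (u : Fin n → ℝ) (N : Pair n → Ω → ℕ) (X : Pair n → Fin T → Ω → ℤ) : Prop where
  law_count : ∀ e, HasLaw (N e) (binomial T p) μ
  law_outcome : ∀ e t, HasLaw (X e t) (tmLaw (relScore u e)) μ
  indep : iIndepFun (β := fun _ : Pair n ⊕ (Pair n × Fin T) => ℤ)
    (Sum.elim (fun e ω => (N e ω : ℤ)) (fun q ω => X q.1 q.2 ω)) μ

/-- The conditional log-likelihood
`l(v) = ∑_{i < j} ∑_{t < n_{ij}} log f(X_{ij}^{(t)}; v_i - v_j)` of observed data. -/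
def logLik {T n : ℕ} (N : Pair n → ℕ) (X : Pair n → Fin T → ℤ) (v : Fin n → ℝ) : ℝ :=
  ∑ e : Pair n, ∑ t : Fin T,
    if (t : ℕ) < N e then Real.log (tmMass (X e t) (relScore v e)) else 0

/-- `v` maximises the log-likelihood over the score vectors whose first entry is `0`. -/
def IsMLE {T n : ℕ} (N : Pair n → ℕ) (X : Pair n → Fin T → ℤ) (v : Fin n → ℝ) : Prop :=
  FirstZero v ∧ ∀ w : Fin n → ℝ, FirstZero w → logLik N X w ≤ logLik N X v

/-- The MLE exists, is unique, and lies within distance `r` of `u` in the sup norm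
(which is the norm of `Fin n → ℝ`). -/
def MLEUniqueWithin {T n : ℕ} (N : Pair n → ℕ) (X : Pair n → Fin T → ℤ) (u : Fin n → ℝ)
    (r : ℝ) : Prop :=
  (∃! v, IsMLE N X v) ∧ ∀ v, IsMLE N X v → ‖v - u‖ ≤ r

/-- `sqrt(log n / (n p)) * (log n / log (n p))`. -/
def sparsityRate (n : ℕ) (p : ℝ) : ℝ :=
  Real.sqrt (Real.log n / (n * p)) * (Real.log n / Real.log (n * p))

/-- `Δ = M exp(M ^ 2) sqrt(log n / (n p)) * (log n / log (n p))`. -/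
def tmRate (n : ℕ) (p M : ℝ) : ℝ := M * Real.exp (M ^ 2) * sparsityRate n p

end PairwiseComparison

end

/-!
Write `M` for the dynamic range of the true scores `u`. By Bernstein's inequality the entries of the
score vector (the gradient of the log-likelihood) at `u` are at most `z`, of order
`exp M * √(n p log n)`. Let `v` maximise the log-likelihood over a ball around `u` and let
`A c = {i | c ≤ v i - u i}`. The entries of the score vector at `v` over `A c` have a nonnegative
sum, those at `u` have a sum of at most `z * #(A c)`, and each compared pair with one member in
`A c` and one outside `A (c - b)` contributes at least `minCurvature M * b` to the decrease from `u`
to `v`. Hence there are few such pairs, and vertex expansion of the random comparison graph forces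
`A (c - b)` to be larger than `A c` by a factor `n p / (64 log n)`. After `k ≍ log n / log (n p)`
steps of size `b ≍ exp (M ^ 2) * √(log n / (n p))` the superlevel set contains more than half of the
subjects. By symmetry so do the sublevel sets, whence `v - u` oscillates by at most
`2 k b ≲ Δ + ρ`. This bound does not depend on the ball, so `v` is a global maximiser.
-/

noncomputable section

namespace PairwiseComparison

/-! ### The standard normal density and distribution function -/

/-- The standard normal density, the derivative of `probit`. -/
def normalDensity (y : ℝ) : ℝ := gaussianPDFReal 0 1 y

lemma normalDensity_eq (y : ℝ) :
    normalDensity y = 1 / √(2 * Real.pi) * Real.exp (-(y ^ 2) / 2) := by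
  simp [normalDensity, gaussianPDFReal]

lemma normalDensity_pos (y : ℝ) : 0 < normalDensity y :=
  gaussianPDFReal_pos 0 1 y one_ne_zero

lemma normalDensity_neg (y : ℝ) : normalDensity (-y) = normalDensity y := by
  simp only [normalDensity_eq, neg_sq]

lemma normalDensity_le_of_abs_le {x y : ℝ} (h : |x| ≤ |y|) :
    normalDensity y ≤ normalDensity x := by
  have hsq : x ^ 2 ≤ y ^ 2 := sq_le_sq.2 h
  rw [normalDensity_eq, normalDensity_eq]
  gcongr

lemma hasDerivAt_normalDensity (y : ℝ) :
    HasDerivAt normalDensity (-y * normalDensity y) y := by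
  have hexp := ((((hasDerivAt_pow 2 y).fun_neg).div_const 2).exp).const_mul (1 / √(2 * Real.pi))
  convert! hexp using 1
  · exact funext normalDensity_eq
  · rw [normalDensity_eq]
    push_cast
    ring_nf

lemma continuous_normalDensity : Continuous normalDensity :=
  continuous_iff_continuousAt.2 fun y => (hasDerivAt_normalDensity y).continuousAt

lemma integrable_normalDensity : Integrable normalDensity :=
  integrable_gaussianPDFReal 0 1

lemma integrable_mul_normalDensity : Integrable fun x => x * normalDensity x := by
  convert! (integrable_mul_exp_neg_mul_sq (b := 1 / 2) (by norm_num)).const_mul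
    (1 / √(2 * Real.pi)) using 2 with x
  rw [normalDensity_eq]
  ring_nf

lemma probit_eq_setIntegral (y : ℝ) : probit y = ∫ x in Set.Iic y, normalDensity x := by
  simp_rw [probit, normalDensity_eq, integral_const_mul]

lemma probit_neg (y : ℝ) : probit (-y) = 1 - probit y := by
  have hreflect := integral_comp_neg_Iic (-y) normalDensity
  simp_rw [normalDensity_neg, neg_neg] at hreflect
  have hsplit := intervalIntegral.integral_Iic_add_Ioi (b := y)
    integrable_normalDensity.integrableOn integrable_normalDensity.integrableOn
  have htotal : ∫ x, normalDensity x = 1 := integral_gaussianPDFReal_eq_one 0 one_ne_zero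
  rw [probit_eq_setIntegral, probit_eq_setIntegral]
  linarith

lemma hasDerivAt_probit (y : ℝ) : HasDerivAt probit (normalDensity y) y := by
  have hprobit : probit = fun y => probit 0 + ∫ x in (0 : ℝ)..y, normalDensity x := by
    funext y
    rw [← intervalIntegral.integral_Iic_sub_Iic integrable_normalDensity.integrableOn
      integrable_normalDensity.integrableOn, probit_eq_setIntegral, probit_eq_setIntegral,
      add_sub_cancel]
  rw [hprobit]
  exact (continuous_normalDensity.integral_hasStrictDerivAt 0 y).hasDerivAt.const_add _

lemma strictMono_probit : StrictMono probit :=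
  strictMono_of_deriv_pos fun y => (hasDerivAt_probit y).deriv ▸ normalDensity_pos y

lemma probit_nonneg (y : ℝ) : 0 ≤ probit y := by
  rw [probit_eq_setIntegral]
  exact integral_nonneg fun x => (normalDensity_pos x).le

lemma probit_pos (y : ℝ) : 0 < probit y :=
  (probit_nonneg (y - 1)).trans_lt (strictMono_probit (sub_one_lt y))

lemma probit_lt_one (y : ℝ) : probit y < 1 := by
  linarith [probit_pos (-y), probit_neg y]

lemma normalDensity_add_one_le_probit_neg {s : ℝ} (hs : 0 ≤ s) :
    normalDensity (s + 1) ≤ probit (-s) := by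
  obtain ⟨c, ⟨hc_lower, hc_upper⟩, hslope⟩ := exists_hasDerivAt_eq_slope probit normalDensity
    (a := -s - 1) (b := -s) (sub_one_lt _)
    (HasDerivAt.continuousOn fun x _ => hasDerivAt_probit x) (fun x _ => hasDerivAt_probit x)
  rw [show -s - (-s - 1) = 1 by ring, div_one] at hslope
  have hdensity : normalDensity (s + 1) ≤ normalDensity c := by
    apply normalDensity_le_of_abs_le
    rw [abs_of_nonneg (by linarith : 0 ≤ s + 1), abs_le]
    constructor <;> linarith
  linarith [probit_nonneg (-s - 1)]

/-- The primitive `y Φ(y) + φ(y)` of the normal distribution function `Φ` that vanishes at `-∞`.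
It is the numerator in the derivative of the inverse Mills ratio. -/
def probitPrimitive (y : ℝ) : ℝ := y * probit y + normalDensity y

lemma hasDerivAt_probitPrimitive (y : ℝ) : HasDerivAt probitPrimitive (probit y) y := by
  convert! ((hasDerivAt_id y).mul (hasDerivAt_probit y)).add (hasDerivAt_normalDensity y) using 1
  simp

lemma strictMono_probitPrimitive : StrictMono probitPrimitive :=
  strictMono_of_deriv_pos fun y => (hasDerivAt_probitPrimitive y).deriv ▸ probit_pos y

lemma probitPrimitive_eq_setIntegral (y : ℝ) :
    probitPrimitive y = ∫ x in Set.Iic y, (y - x) * normalDensity x := by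
  have hint : Integrable fun x => -x * normalDensity x := by
    simpa only [neg_mul] using integrable_mul_normalDensity.fun_neg
  have hdensity := integral_Iic_of_hasDerivAt_of_tendsto' (a := y)
    (fun x _ => hasDerivAt_normalDensity x) hint.integrableOn
    (tendsto_zero_of_hasDerivAt_of_integrableOn_Iic (a := y)
      (fun x _ => hasDerivAt_normalDensity x) hint.integrableOn
      integrable_normalDensity.integrableOn)
  simp_rw [sub_eq_add_neg y, add_mul]
  rw [integral_add (integrable_normalDensity.const_mul y).integrableOn hint.integrableOn,
    integral_const_mul, hdensity, ← probit_eq_setIntegral, sub_zero, probitPrimitive]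

lemma probitPrimitive_nonneg (y : ℝ) : 0 ≤ probitPrimitive y := by
  rw [probitPrimitive_eq_setIntegral]
  exact setIntegral_nonneg measurableSet_Iic fun x hx =>
    mul_nonneg (sub_nonneg.2 hx) (normalDensity_pos x).le

lemma probitPrimitive_pos (y : ℝ) : 0 < probitPrimitive y :=
  (probitPrimitive_nonneg (y - 1)).trans_lt (strictMono_probitPrimitive (sub_one_lt y))

lemma normalDensity_add_two_le_probitPrimitive_neg {s : ℝ} (hs : 0 ≤ s) :
    normalDensity (s + 2) ≤ probitPrimitive (-s) := by
  obtain ⟨c, ⟨hc_lower, _⟩, hslope⟩ := exists_hasDerivAt_eq_slope probitPrimitive probit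
    (a := -s - 1) (b := -s) (sub_one_lt _)
    (HasDerivAt.continuousOn fun x _ => hasDerivAt_probitPrimitive x)
    (fun x _ => hasDerivAt_probitPrimitive x)
  rw [show -s - (-s - 1) = 1 by ring, div_one] at hslope
  calc normalDensity (s + 2) = normalDensity (s + 1 + 1) := by ring_nf
    _ ≤ probit (-(s + 1)) := normalDensity_add_one_le_probit_neg (by linarith)
    _ ≤ probit c := strictMono_probit.monotone (by linarith)
    _ ≤ probitPrimitive (-s) := by linarith [probitPrimitive_nonneg (-s - 1)]

/-! ### The inverse Mills ratio -/

/-- The inverse Mills ratio `φ / Φ`, the derivative of `log Φ`. -/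
def invMills (y : ℝ) : ℝ := normalDensity y / probit y

lemma invMills_pos (y : ℝ) : 0 < invMills y := div_pos (normalDensity_pos y) (probit_pos y)

lemma hasDerivAt_invMills (y : ℝ) :
    HasDerivAt invMills (-(invMills y * (probitPrimitive y / probit y))) y := by
  have hne := (probit_pos y).ne'
  convert! (hasDerivAt_normalDensity y).div (hasDerivAt_probit y) hne using 1
  unfold invMills probitPrimitive
  field_simp
  ring

lemma strictAnti_invMills : StrictAnti invMills :=
  strictAnti_of_deriv_neg fun y => by
    rw [(hasDerivAt_invMills y).deriv, neg_lt_zero]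
    exact mul_pos (invMills_pos y) (div_pos (probitPrimitive_pos y) (probit_pos y))

lemma invMills_le_exp {M y : ℝ} (hM : 0 ≤ M) (hy : -M ≤ y) :
    invMills y ≤ Real.exp (M + 1 / 2) := by
  refine (strictAnti_invMills.antitone hy).trans ?_
  rw [invMills, div_le_iff₀ (probit_pos _), normalDensity_neg]
  calc normalDensity M = Real.exp (M + 1 / 2) * normalDensity (M + 1) := by
        rw [normalDensity_eq, normalDensity_eq, mul_left_comm, ← Real.exp_add]
        ring_nf
    _ ≤ Real.exp (M + 1 / 2) * probit (-M) := by
        gcongr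
        exact normalDensity_add_one_le_probit_neg hM

/-- A lower bound of the curvature `-(log Φ)''` on the interval `[-(M + 1), M + 1]`. -/
def minCurvature (M : ℝ) : ℝ := normalDensity 0 * normalDensity (M + 3)

lemma minCurvature_pos (M : ℝ) : 0 < minCurvature M :=
  mul_pos (normalDensity_pos _) (normalDensity_pos _)

lemma minCurvature_le {M y : ℝ} (hy : |y| ≤ M + 1) :
    minCurvature M ≤ invMills y * (probitPrimitive y / probit y) := by
  have hM : 0 ≤ M + 1 := (abs_nonneg y).trans hy
  have le_div_probit {a : ℝ} (z : ℝ) (ha : 0 ≤ a) : a ≤ a / probit z :=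
    le_div_self ha (probit_pos z) (probit_lt_one z).le
  have hprim := le_div_probit y (probitPrimitive_nonneg y)
  have hzero := (normalDensity_pos 0).le
  obtain hy0 | hy0 := le_total 0 y
  · have hmills : normalDensity (M + 3) ≤ invMills y := by
      refine (normalDensity_le_of_abs_le ?_).trans (le_div_probit y (normalDensity_pos y).le)
      rw [abs_of_nonneg (by linarith : 0 ≤ M + 3)]
      linarith
    have hprim0 : normalDensity 0 ≤ probitPrimitive y := by
      simpa [probitPrimitive] using strictMono_probitPrimitive.monotone hy0
    rw [minCurvature, mul_comm]
    exact mul_le_mul hmills (hprim0.trans hprim) hzero (invMills_pos y).le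
  · have hmills : normalDensity 0 ≤ invMills y :=
      (le_div_probit 0 hzero).trans (strictAnti_invMills.antitone hy0)
    have hprimM : normalDensity (M + 3) ≤ probitPrimitive y :=
      calc normalDensity (M + 3) = normalDensity (M + 1 + 2) := by ring_nf
        _ ≤ probitPrimitive (-(M + 1)) := normalDensity_add_two_le_probitPrimitive_neg hM
        _ ≤ probitPrimitive y := strictMono_probitPrimitive.monotone (abs_le.1 hy).1
    exact mul_le_mul hmills (hprimM.trans hprim) (normalDensity_pos _).le (invMills_pos y).le

lemma minCurvature_mul_le_invMills_sub {M y z : ℝ} (hy : |y| ≤ M + 1) (hz : |z| ≤ M + 1)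
    (hyz : y ≤ z) : minCurvature M * (z - y) ≤ invMills y - invMills z := by
  have hslope := (convex_Icc (-(M + 1)) (M + 1)).image_sub_le_mul_sub_of_deriv_le
    (f := invMills) (C := -minCurvature M)
    (HasDerivAt.continuousOn fun x _ => hasDerivAt_invMills x)
    (fun x _ => (hasDerivAt_invMills x).differentiableAt.differentiableWithinAt)
    (fun x hx => by
      rw [(hasDerivAt_invMills x).deriv]
      exact neg_le_neg (minCurvature_le (abs_le.2 (Set.mem_Icc.1 (interior_subset hx)))))
    y (abs_le.1 hy) z (abs_le.1 hz) hyz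
  linarith

/-! ### The score function of the Thurstone-Mosteller model -/

/-- The score function of the Thurstone-Mosteller model, i.e. the derivative in `y` of
`log f(x; y)`. -/
def score (x : ℤ) (y : ℝ) : ℝ :=
  if x = 1 then invMills y else if x = -1 then -invMills (-y) else 0

lemma score_one (y : ℝ) : score 1 y = invMills y := by simp [score]

lemma score_neg_one (y : ℝ) : score (-1) y = -invMills (-y) := by simp [score]

lemma tmMass_one (y : ℝ) : tmMass 1 y = probit y := by simp [tmMass]

lemma tmMass_neg_one (y : ℝ) : tmMass (-1) y = probit (-y) := by simp [tmMass, probit_neg]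

lemma tmMass_neg_neg (x : ℤ) (y : ℝ) : tmMass (-x) (-y) = tmMass x y := by
  obtain rfl | rfl | hx : x = 1 ∨ x = -1 ∨ (x ≠ 1 ∧ x ≠ -1) := by tauto
  · rw [tmMass_one, tmMass_neg_one, neg_neg]
  · rw [neg_neg, tmMass_one, tmMass_neg_one]
  · simp [tmMass, hx, neg_eq_iff_eq_neg]

lemma score_neg_neg (x : ℤ) (y : ℝ) : score (-x) (-y) = -score x y := by
  obtain rfl | rfl | hx : x = 1 ∨ x = -1 ∨ (x ≠ 1 ∧ x ≠ -1) := by tauto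
  · rw [score_one, score_neg_one, neg_neg]
  · rw [neg_neg, score_one, score_neg_one, neg_neg]
  · simp [score, hx, neg_eq_iff_eq_neg]

lemma hasDerivAt_log_tmMass (x : ℤ) (y : ℝ) :
    HasDerivAt (fun y => Real.log (tmMass x y)) (score x y) y := by
  obtain rfl | rfl | hx : x = 1 ∨ x = -1 ∨ (x ≠ 1 ∧ x ≠ -1) := by tauto
  · simp_rw [tmMass_one, score_one]
    exact (hasDerivAt_probit y).log (probit_pos y).ne'
  · simp_rw [tmMass_neg_one, score_neg_one]
    convert! ((hasDerivAt_probit (-y)).comp y (hasDerivAt_neg y)).log (probit_pos (-y)).ne'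
      using 1
    simp [invMills, neg_div]
  · simp only [tmMass, score, hx, if_false, Real.log_zero]
    exact hasDerivAt_const _ _

lemma abs_score_le {M y : ℝ} (x : ℤ) (hy : |y| ≤ M) : |score x y| ≤ Real.exp (M + 1 / 2) := by
  have hM : 0 ≤ M := (abs_nonneg y).trans hy
  obtain ⟨hy_lower, hy_upper⟩ := abs_le.1 hy
  unfold score
  split_ifs
  · rw [abs_of_pos (invMills_pos _)]
    exact invMills_le_exp hM hy_lower
  · rw [abs_neg, abs_of_pos (invMills_pos _)]
    exact invMills_le_exp hM (neg_le_neg hy_upper)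
  · rw [abs_zero]
    positivity

lemma antitone_score {x : ℤ} (hx : x = 1 ∨ x = -1) : Antitone (score x) := by
  intro y z hyz
  obtain rfl | rfl := hx
  · simpa only [score_one] using strictAnti_invMills.antitone hyz
  · simpa only [score_neg_one, neg_le_neg_iff] using strictAnti_invMills.antitone (neg_le_neg hyz)

lemma minCurvature_mul_le_score_sub {M y z : ℝ} {x : ℤ} (hx : x = 1 ∨ x = -1)
    (hy : |y| ≤ M + 1) (hz : |z| ≤ M + 1) (hyz : y ≤ z) :
    minCurvature M * (z - y) ≤ score x y - score x z := by
  obtain rfl | rfl := hx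
  · simpa only [score_one] using minCurvature_mul_le_invMills_sub hy hz hyz
  · have h := minCurvature_mul_le_invMills_sub (M := M) (y := -z) (z := -y)
      (by rwa [abs_neg]) (by rwa [abs_neg]) (neg_le_neg hyz)
    simp only [score_neg_one]
    linarith

-- Only `y` is confined to `[-M, M]`: the curvature on the way from `y` to `y + σ b` already
-- yields the bound, and beyond that point antitonicity of the score suffices.
lemma minCurvature_mul_le_sign_mul_score_sub {M b y z σ : ℝ} {x : ℤ} (hx : x = 1 ∨ x = -1)
    (hσ : σ = 1 ∨ σ = -1) (hb : 0 ≤ b) (hb1 : b ≤ 1) (hy : |y| ≤ M) (h : b ≤ σ * (z - y)) :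
    minCurvature M * b ≤ σ * (score x y - score x z) := by
  have hyM : |y| ≤ M + 1 := hy.trans (by linarith)
  obtain ⟨hy_lower, hy_upper⟩ := abs_le.1 hy
  obtain rfl | rfl := hσ
  · have hcurv := minCurvature_mul_le_score_sub hx hyM
      (abs_le.2 ⟨by linarith, by linarith⟩ : |y + b| ≤ M + 1) (by linarith)
    have hanti := antitone_score hx (by linarith : y + b ≤ z)
    rw [add_sub_cancel_left] at hcurv
    linarith
  · have hcurv := minCurvature_mul_le_score_sub hx
      (abs_le.2 ⟨by linarith, by linarith⟩ : |y - b| ≤ M + 1) hyM (by linarith)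
    have hanti := antitone_score hx (by linarith : z ≤ y - b)
    rw [sub_sub_cancel] at hcurv
    linarith

/-! ### The score vector -/

section ScoreVector

variable {T n : ℕ} {N : Pair n → ℕ} {X : Pair n → Fin T → ℤ} {u v w : Fin n → ℝ}

lemma relScore_neg (v : Fin n → ℝ) (e : Pair n) : relScore (-v) e = -relScore v e := by
  simp only [relScore, Pi.neg_apply, neg_sub_neg, neg_sub]

lemma relScore_sub (v w : Fin n → ℝ) (e : Pair n) :
    relScore (v - w) e = relScore v e - relScore w e := by
  simp only [relScore, Pi.sub_apply]
  ring

lemma abs_relScore_le_dynamicRange (u : Fin n → ℝ) (e : Pair n) :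
    |relScore u e| ≤ dynamicRange u :=
  le_ciSup (Set.finite_range fun e : Fin n × Fin n => |u e.1 - u e.2|).bddAbove e.1

/-- The differential of `v ↦ v_i - v_j` for the pair `e = (i, j)`. -/
def relScoreCLM (e : Pair n) : (Fin n → ℝ) →L[ℝ] ℝ :=
  (ContinuousLinearMap.proj e.1.1 : (Fin n → ℝ) →L[ℝ] ℝ) - ContinuousLinearMap.proj e.1.2

lemma relScoreCLM_apply (e : Pair n) (v : Fin n → ℝ) : relScoreCLM e v = relScore v e := rfl

variable (N X) in
/-- The score of the model at `v`, i.e. the differential of the log-likelihood at `v`. -/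
def scoreForm (v : Fin n → ℝ) : (Fin n → ℝ) →L[ℝ] ℝ :=
  ∑ e : Pair n, ∑ t : Fin T,
    if (t : ℕ) < N e then score (X e t) (relScore v e) • relScoreCLM e else 0

lemma scoreForm_apply (v w : Fin n → ℝ) :
    scoreForm N X v w = ∑ e : Pair n, ∑ t : Fin T,
      if (t : ℕ) < N e then score (X e t) (relScore v e) * relScore w e else 0 := by
  simp only [scoreForm, sum_apply]
  refine Finset.sum_congr rfl fun e _ => Finset.sum_congr rfl fun t _ => ?_
  split_ifs <;> simp [relScoreCLM_apply]

lemma hasFDerivAt_logLik (v : Fin n → ℝ) : HasFDerivAt (logLik N X) (scoreForm N X v) v := by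
  refine HasFDerivAt.fun_sum fun e _ => HasFDerivAt.fun_sum fun t _ => ?_
  split_ifs
  · exact (hasDerivAt_log_tmMass (X e t) (relScoreCLM e v)).comp_hasFDerivAt v
      (relScoreCLM e).hasFDerivAt
  · exact hasFDerivAt_const _ _

lemma continuous_logLik : Continuous (logLik N X) :=
  continuous_iff_continuousAt.2 fun v => (hasFDerivAt_logLik v).continuousAt

lemma logLik_sub_const (v : Fin n → ℝ) (c : ℝ) :
    logLik N X (v - Function.const _ c) = logLik N X v := by
  simp [logLik, relScore]

lemma scoreForm_const (v : Fin n → ℝ) (c : ℝ) : scoreForm N X v (Function.const _ c) = 0 := by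
  simp [scoreForm_apply, relScore]

-- Interchanging winners and losers is the same as negating all scores.
lemma logLik_neg_neg (v : Fin n → ℝ) : logLik N (-X) (-v) = logLik N X v := by
  simp only [logLik, relScore_neg, Pi.neg_apply, tmMass_neg_neg]

lemma scoreForm_neg_neg (v w : Fin n → ℝ) : scoreForm N (-X) (-v) w = -scoreForm N X v w := by
  simp only [scoreForm_apply, relScore_neg, Pi.neg_apply, score_neg_neg, ← Finset.sum_neg_distrib]
  refine Finset.sum_congr rfl fun e _ => Finset.sum_congr rfl fun t _ => ?_
  split_ifs <;> ring

/-- The subjects at which `f` is at least `c`. -/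
def superlevel {ι : Type*} [Fintype ι] (f : ι → ℝ) (c : ℝ) : Finset ι := {i | c ≤ f i}

lemma mem_superlevel {ι : Type*} [Fintype ι] {f : ι → ℝ} {c : ℝ} {i : ι} :
    i ∈ superlevel f c ↔ c ≤ f i := by
  simp [superlevel]

lemma superlevel_anti {ι : Type*} [Fintype ι] (f : ι → ℝ) : Antitone (superlevel f) :=
  fun _ _ h _ hi => mem_superlevel.2 (h.trans (mem_superlevel.1 hi))

/-- The indicator vector of a set of subjects. -/
def indVec (A : Finset (Fin n)) : Fin n → ℝ := fun i => if i ∈ A then 1 else 0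

lemma indVec_eq_sum_single (A : Finset (Fin n)) : indVec A = ∑ i ∈ A, Pi.single i (1 : ℝ) := by
  funext j
  simp [indVec, Finset.sum_apply, Pi.single_apply]

lemma abs_scoreForm_indVec_le {z : ℝ} (hz : ∀ i, |scoreForm N X u (Pi.single i 1)| ≤ z)
    (A : Finset (Fin n)) : |scoreForm N X u (indVec A)| ≤ z * A.card := by
  rw [indVec_eq_sum_single, map_sum, mul_comm, ← nsmul_eq_mul]
  exact (Finset.abs_sum_le_sum_abs _ _).trans (Finset.sum_le_card_nsmul _ _ z fun i _ => hz i)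

lemma relScore_indVec_superlevel_mul_nonneg (f : Fin n → ℝ) (c : ℝ) (e : Pair n) :
    0 ≤ relScore (indVec (superlevel f c)) e * relScore f e := by
  simp only [relScore, indVec, mem_superlevel]
  split_ifs <;> linarith

-- First-order conditions at a maximiser over a ball: decreasing `v` on a superlevel set of
-- `v - u` does not leave the ball, unless this set contains all subjects.
lemma scoreForm_indVec_superlevel_nonneg {R c : ℝ} (hv : v ∈ Metric.closedBall u R)
    (hmax : IsMaxOn (logLik N X) (Metric.closedBall u R) v) :
    0 ≤ scoreForm N X v (indVec (superlevel (v - u) c)) := by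
  have hvR (i : Fin n) : |v i - u i| ≤ R :=
    (norm_le_pi_norm (v - u) i).trans (mem_closedBall_iff_norm.1 hv)
  have hR : 0 ≤ R := dist_nonneg.trans hv
  obtain hc | hc := le_or_gt c (-R)
  · have hconst : indVec (superlevel (v - u) c) = Function.const _ 1 := by
      funext i
      exact if_pos (mem_superlevel (f := v - u).2 (hc.trans (abs_le.1 (hvR i)).1))
    rw [hconst, scoreForm_const]
  · set w := indVec (superlevel (v - u) c) with hw
    have hmem : v + -(c + R) • w ∈ Metric.closedBall u R := by
      rw [mem_closedBall_iff_norm, pi_norm_le_iff_of_nonneg hR]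
      intro i
      obtain ⟨hlower, hupper⟩ := abs_le.1 (hvR i)
      simp only [hw, indVec, mem_superlevel, Pi.sub_apply, Pi.add_apply, Pi.smul_apply, smul_eq_mul,
        Real.norm_eq_abs, abs_le]
      split_ifs <;> constructor <;> linarith
    have hdir := hmax.localize.hasFDerivWithinAt_nonpos
      (hasFDerivAt_logLik v).hasFDerivWithinAt (mem_posTangentConeAt_of_segment_subset
        ((convex_closedBall u R).segment_subset hv hmem))
    rw [map_smul, smul_eq_mul, neg_mul, neg_nonpos] at hdir
    exact nonneg_of_mul_nonneg_right hdir (by linarith)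

end ScoreVector

/-! ### Monotonicity of the score along superlevel sets -/

section Monotonicity

variable {T n : ℕ} {N : Pair n → ℕ} {X : Pair n → Fin T → ℤ} {u v : Fin n → ℝ}

/-- The pairs with one member in `A` and one in `D`. -/
def cutPairs (A D : Finset (Fin n)) : Finset (Pair n) :=
  {e | (e.1.1 ∈ A ∧ e.1.2 ∈ D) ∨ (e.1.1 ∈ D ∧ e.1.2 ∈ A)}

variable (N) in
/-- The pairs with one member in `A` and one in `D` which are compared at least once. -/
def comparedPairs (A D : Finset (Fin n)) : Finset (Pair n) := {e ∈ cutPairs A D | 0 < N e}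

lemma scoreForm_sub_scoreForm (u v w : Fin n → ℝ) :
    scoreForm N X u w - scoreForm N X v w = ∑ e : Pair n, ∑ t : Fin T, if (t : ℕ) < N e then
      (score (X e t) (relScore u e) - score (X e t) (relScore v e)) * relScore w e else 0 := by
  simp_rw [scoreForm_apply, ← Finset.sum_sub_distrib]
  refine Finset.sum_congr rfl fun e _ => Finset.sum_congr rfl fun t _ => ?_
  split_ifs <;> ring

lemma score_sub_score_mul_nonneg {x : ℤ} (hx : x = 1 ∨ x = -1) {y z s : ℝ}
    (h : 0 ≤ s * (z - y)) : 0 ≤ (score x y - score x z) * s := by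
  obtain hs | rfl | hs := lt_trichotomy s 0
  · exact mul_nonneg_of_nonpos_of_nonpos
      (sub_nonpos.2 (antitone_score hx (sub_nonpos.1 (nonpos_of_mul_nonneg_right h hs)))) hs.le
  · rw [mul_zero]
  · exact mul_nonneg
      (sub_nonneg.2 (antitone_score hx (sub_nonneg.1 (nonneg_of_mul_nonneg_right h hs)))) hs.le

lemma minCurvature_mul_le_of_mem_comparedPairs {M b c : ℝ} {x : ℤ} {e : Pair n}
    (hx : x = 1 ∨ x = -1) (hM : |relScore u e| ≤ M) (hb : 0 ≤ b) (hb1 : b ≤ 1)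
    (he : e ∈ comparedPairs N (superlevel (v - u) c) (superlevel (v - u) (c - b))ᶜ) :
    minCurvature M * b ≤ (score x (relScore u e) - score x (relScore v e)) *
      relScore (indVec (superlevel (v - u) c)) e := by
  simp only [comparedPairs, cutPairs, Finset.mem_filter, Finset.mem_univ, true_and,
    Finset.mem_compl, mem_superlevel, not_le] at he
  rw [mul_comm _ (relScore _ e)]
  have hcross : (relScore (indVec (superlevel (v - u) c)) e = 1 ∧ b ≤ relScore (v - u) e) ∨
      (relScore (indVec (superlevel (v - u) c)) e = -1 ∧ b ≤ -relScore (v - u) e) := by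
    simp only [relScore, indVec, mem_superlevel]
    obtain ⟨⟨hin, hout⟩ | ⟨hout, hin⟩, -⟩ := he
    · rw [if_pos hin, if_neg (by linarith)]
      exact Or.inl ⟨by norm_num, by linarith⟩
    · rw [if_pos hin, if_neg (by linarith)]
      exact Or.inr ⟨by norm_num, by linarith⟩
  refine minCurvature_mul_le_sign_mul_score_sub hx (hcross.imp And.left And.left) hb hb1 hM ?_
  rw [← relScore_sub]
  obtain ⟨hs, hgap⟩ | ⟨hs, hgap⟩ := hcross <;> rw [hs] <;> linarith

lemma minCurvature_mul_card_comparedPairs_le [NeZero T] {M b : ℝ}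
    (hX : ∀ e t, X e t = 1 ∨ X e t = -1) (hM : ∀ e : Pair n, |relScore u e| ≤ M) (hb : 0 ≤ b)
    (hb1 : b ≤ 1) (c : ℝ) :
    minCurvature M * b *
        (comparedPairs N (superlevel (v - u) c) (superlevel (v - u) (c - b))ᶜ).card ≤
      scoreForm N X u (indVec (superlevel (v - u) c)) -
        scoreForm N X v (indVec (superlevel (v - u) c)) := by
  set A := superlevel (v - u) c
  set E := comparedPairs N A (superlevel (v - u) (c - b))ᶜ
  let gain (e : Pair n) (t : Fin T) : ℝ := if (t : ℕ) < N e then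
    (score (X e t) (relScore u e) - score (X e t) (relScore v e)) * relScore (indVec A) e else 0
  have hgain (e : Pair n) (t : Fin T) : 0 ≤ gain e t := by
    unfold gain
    split_ifs
    · exact score_sub_score_mul_nonneg (hX e t)
        (relScore_sub v u e ▸ relScore_indVec_superlevel_mul_nonneg (v - u) c e)
    · rfl
  have hgain_compared (e : Pair n) (he : e ∈ E) : minCurvature M * b ≤ gain e 0 := by
    have hcompared : ((0 : Fin T) : ℕ) < N e := (Finset.mem_filter.1 he).2
    unfold gain
    rw [if_pos hcompared]
    exact minCurvature_mul_le_of_mem_comparedPairs (hX e 0) (hM e) hb hb1 he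
  calc minCurvature M * b * E.card ≤ ∑ e ∈ E, gain e 0 := by
        rw [mul_comm, ← nsmul_eq_mul]
        exact Finset.card_nsmul_le_sum _ _ _ hgain_compared
    _ ≤ ∑ e ∈ E, ∑ t, gain e t := Finset.sum_le_sum fun e _ =>
        Finset.single_le_sum (fun t _ => hgain e t) (Finset.mem_univ 0)
    _ ≤ ∑ e, ∑ t, gain e t := Finset.sum_le_univ_sum_of_nonneg fun e =>
        Finset.sum_nonneg fun t _ => hgain e t
    _ = _ := (scoreForm_sub_scoreForm u v _).symm

end Monotonicity

/-! ### Vertex expansion and the error of the MLE -/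

section Expansion

variable {T n : ℕ} {N : Pair n → ℕ} {X : Pair n → Fin T → ℤ} {u v w : Fin n → ℝ}
  {M G L b z : ℝ} {k : ℕ}

variable (N) in
/-- Vertex expansion of the comparison graph: every set `A` of subjects has at least `L * #A`
compared pairs leaving a set `A' ⊇ A`, as long as `A'` has at most `n / 2` and at most `G * #A`
elements. -/
def HasExpansion (G L : ℝ) : Prop :=
  ∀ A A' : Finset (Fin n), A.Nonempty → A ⊆ A' → 2 * A'.card ≤ n → (A'.card : ℝ) ≤ G * A.card →
    L * A.card ≤ (comparedPairs N A A'ᶜ).card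

-- Lowering the level by `b` multiplies the cardinality of the superlevel set by `G`: otherwise
-- expansion would provide more compared pairs than `hf` allows.
lemma pow_le_card_superlevel {f : Fin n → ℝ} {a : ℝ} (hG : 0 ≤ G) (hexp : HasExpansion N G L)
    (hb : 0 ≤ b) (ha : 0 ≤ a) (hz : z < a * L)
    (hf : ∀ c, a * (comparedPairs N (superlevel f c) (superlevel f (c - b))ᶜ).card ≤
      z * (superlevel f c).card) (i : Fin n) (j : ℕ) :
    n < 2 * (superlevel f (f i - j * b)).card ∨ G ^ j ≤ (superlevel f (f i - j * b)).card := by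
  have hne (j : ℕ) : (superlevel f (f i - j * b)).Nonempty :=
    ⟨i, mem_superlevel.2 (sub_le_self _ (by positivity))⟩
  induction j with
  | zero =>
    right
    rw [pow_zero]
    exact_mod_cast (hne 0).card_pos
  | succ j ih =>
    have hlevel : f i - (j + 1 : ℕ) * b = f i - j * b - b := by push_cast; ring
    rw [hlevel]
    set c := f i - j * b
    have hsub : superlevel f c ⊆ superlevel f (c - b) := superlevel_anti f (sub_le_self _ hb)
    by_contra! h
    obtain ⟨hhalf, hsmall⟩ := h
    have hpow : G ^ j ≤ (superlevel f c).card :=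
      ih.resolve_left (by have := Finset.card_le_card hsub; omega)
    have hexpand := hexp _ _ (hne j) hsub hhalf (hsmall.le.trans (by rw [pow_succ']; gcongr))
    have : (0 : ℝ) < (superlevel f c).card := by exact_mod_cast (hne j).card_pos
    have := calc a * L * (superlevel f c).card = a * (L * (superlevel f c).card) := mul_assoc _ _ _
      _ ≤ a * (comparedPairs N (superlevel f c) (superlevel f (c - b))ᶜ).card := by gcongr
      _ ≤ z * (superlevel f c).card := hf c
      _ < a * L * (superlevel f c).card := by gcongr
    exact this.false

lemma lt_two_mul_card_superlevel_of_isMaxOn [NeZero T] (hX : ∀ e t, X e t = 1 ∨ X e t = -1)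
    (hM : ∀ e : Pair n, |relScore u e| ≤ M) (hG : 0 ≤ G) (hexp : HasExpansion N G L)
    (hk : n < 2 * G ^ k) (hb : 0 ≤ b) (hb1 : b ≤ 1)
    (hu : ∀ i, |scoreForm N X u (Pi.single i 1)| ≤ z) (hz : z < minCurvature M * b * L) {R : ℝ}
    (hv : v ∈ Metric.closedBall u R) (hmax : IsMaxOn (logLik N X) (Metric.closedBall u R) v)
    (i : Fin n) : n < 2 * (superlevel (v - u) (v i - u i - k * b)).card := by
  have hgrowth (c : ℝ) : minCurvature M * b *
      (comparedPairs N (superlevel (v - u) c) (superlevel (v - u) (c - b))ᶜ).card ≤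
        z * (superlevel (v - u) c).card :=
    calc _ ≤ _ := minCurvature_mul_card_comparedPairs_le hX hM hb hb1 c
      _ ≤ scoreForm N X u (indVec (superlevel (v - u) c)) :=
        sub_le_self _ (scoreForm_indVec_superlevel_nonneg hv hmax)
      _ ≤ z * (superlevel (v - u) c).card :=
        (le_abs_self _).trans (abs_scoreForm_indVec_le hu _)
  refine (pow_le_card_superlevel hG hexp hb (mul_nonneg (minCurvature_pos M).le hb) hz hgrowth
    i k).elim id fun hpow => ?_
  have hlt : (n : ℝ) < 2 * (superlevel (v - u) (v i - u i - k * b)).card :=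
    hk.trans_le (mul_le_mul_of_nonneg_left hpow zero_le_two)
  exact_mod_cast hlt

lemma sub_sub_sub_le_of_isMaxOn [NeZero T] (hX : ∀ e t, X e t = 1 ∨ X e t = -1)
    (hM : ∀ e : Pair n, |relScore u e| ≤ M) (hG : 0 ≤ G) (hexp : HasExpansion N G L)
    (hk : n < 2 * G ^ k) (hb : 0 ≤ b) (hb1 : b ≤ 1)
    (hu : ∀ i, |scoreForm N X u (Pi.single i 1)| ≤ z) (hz : z < minCurvature M * b * L) {R : ℝ}
    (hv : v ∈ Metric.closedBall u R) (hmax : IsMaxOn (logLik N X) (Metric.closedBall u R) v)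
    (i j : Fin n) : (v i - u i) - (v j - u j) ≤ 2 * k * b := by
  have hball (w : Fin n → ℝ) : w ∈ Metric.closedBall (-u) R ↔ -w ∈ Metric.closedBall u R := by
    rw [Metric.mem_closedBall, Metric.mem_closedBall, ← dist_neg_neg, neg_neg]
  have hupper := lt_two_mul_card_superlevel_of_isMaxOn hX hM hG hexp hk hb hb1 hu hz hv hmax i
  have hlower := lt_two_mul_card_superlevel_of_isMaxOn (X := -X) (u := -u) (v := -v) (R := R)
    (fun e t => (hX e t).elim (fun h => .inr (by simp [h])) (fun h => .inl (by simp [h])))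
    (fun e => by rw [relScore_neg, abs_neg]; exact hM e) hG hexp hk hb hb1
    (fun i => by rw [scoreForm_neg_neg, abs_neg]; exact hu i) hz
    ((hball _).2 (by rwa [neg_neg]))
    (isMaxOn_iff.2 fun w hw => by
      simpa only [← logLik_neg_neg (X := X), neg_neg] using
        isMaxOn_iff.1 hmax _ ((hball w).1 hw)) j
  obtain ⟨l, hl⟩ : (superlevel (v - u) (v i - u i - k * b) ∩
      superlevel (-v - -u) ((-v) j - (-u) j - k * b)).Nonempty := by
    apply Finset.inter_nonempty_of_card_lt_card_add_card (Finset.subset_univ _)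
      (Finset.subset_univ _)
    rw [Finset.card_univ, Fintype.card_fin]
    omega
  simp only [Finset.mem_inter, mem_superlevel, Pi.sub_apply, Pi.neg_apply] at hl
  linarith [hl.1, hl.2]

variable [NeZero n]

lemma FirstZero.apply_zero (hv : FirstZero v) : v 0 = 0 := hv 0 rfl

lemma firstZero_sub_const (v : Fin n → ℝ) : FirstZero (v - Function.const _ (v 0)) := by
  intro i hi
  obtain rfl : i = 0 := Fin.ext hi
  exact sub_self _

lemma IsMLE.logLik_le (hv : IsMLE N X v) (w : Fin n → ℝ) : logLik N X w ≤ logLik N X v := by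
  rw [← logLik_sub_const w (w 0)]
  exact hv.2 _ (firstZero_sub_const w)

lemma isMLE_sub_const (hv : ∀ w, logLik N X w ≤ logLik N X v) :
    IsMLE N X (v - Function.const _ (v 0)) :=
  ⟨firstZero_sub_const v, fun w _ => (hv w).trans (logLik_sub_const v (v 0)).ge⟩

variable [NeZero T]

lemma IsMLE.norm_sub_le (hX : ∀ e t, X e t = 1 ∨ X e t = -1)
    (hM : ∀ e : Pair n, |relScore u e| ≤ M) (hG : 0 ≤ G) (hexp : HasExpansion N G L)
    (hk : n < 2 * G ^ k) (hb : 0 ≤ b) (hb1 : b ≤ 1)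
    (hu : ∀ i, |scoreForm N X u (Pi.single i 1)| ≤ z) (hz : z < minCurvature M * b * L)
    (hu0 : FirstZero u) (hv : IsMLE N X v) : ‖v - u‖ ≤ 2 * k * b := by
  have hosc := sub_sub_sub_le_of_isMaxOn hX hM hG hexp hk hb hb1 hu hz
    (mem_closedBall_iff_norm.2 le_rfl) (fun w _ => hv.logLik_le w)
  refine (pi_norm_le_iff_of_nonneg (by positivity)).2 fun i => abs_le.2 ?_
  have h0 : v 0 - u 0 = 0 := by rw [hv.1.apply_zero, hu0.apply_zero, sub_self]
  have hi := hosc i 0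
  have hi' := hosc 0 i
  simp only [Pi.sub_apply]
  constructor <;> linarith

lemma IsMLE.eq_of_hasExpansion (hX : ∀ e t, X e t = 1 ∨ X e t = -1) (hG : 0 ≤ G)
    (hexp : HasExpansion N G L) (hL : 0 < L) (hk : n < 2 * G ^ k) (hv : IsMLE N X v)
    (hw : IsMLE N X w) : v = w := by
  have hscore (i : Fin n) : |scoreForm N X w (Pi.single i 1)| ≤ 0 := by
    have hmax : IsLocalMax (logLik N X) w := Eventually.of_forall hw.logLik_le
    simp [hmax.hasFDerivAt_eq_zero (hasFDerivAt_logLik w)]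
  have hdist : ∀ᶠ b : ℝ in 𝓝[>] 0, ‖v - w‖ ≤ 2 * k * b := by
    filter_upwards [Ioc_mem_nhdsGT zero_lt_one] with b ⟨hb, hb1⟩
    exact hv.norm_sub_le hX (abs_relScore_le_dynamicRange w) hG hexp hk hb.le hb1 hscore
      (mul_pos (mul_pos (minCurvature_pos _) hb) hL) hw.1
  have htendsto : Tendsto (fun b : ℝ => 2 * k * b) (𝓝[>] 0) (𝓝 0) := by
    simpa using (tendsto_id.const_mul (2 * k : ℝ)).mono_left (nhdsWithin_le_nhds (a := (0 : ℝ)))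
  exact sub_eq_zero.1 (norm_le_zero_iff.1 (ge_of_tendsto htendsto hdist))

-- A maximiser over a ball of any radius around `u` has oscillation at most `2 * k * b` around `u`,
-- so a shift of it lies in the ball of radius `2 * k * b`, over which a maximiser exists.
lemma exists_isMLE (hX : ∀ e t, X e t = 1 ∨ X e t = -1)
    (hM : ∀ e : Pair n, |relScore u e| ≤ M) (hG : 0 ≤ G) (hexp : HasExpansion N G L)
    (hk : n < 2 * G ^ k) (hb : 0 ≤ b) (hb1 : b ≤ 1)
    (hu : ∀ i, |scoreForm N X u (Pi.single i 1)| ≤ z) (hz : z < minCurvature M * b * L) :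
    ∃ v, IsMLE N X v := by
  have hmax (R : ℝ) (hR : 0 ≤ R) :
      ∃ v ∈ Metric.closedBall u R, IsMaxOn (logLik N X) (Metric.closedBall u R) v :=
    (isCompact_closedBall u R).exists_isMaxOn (Metric.nonempty_closedBall.2 hR)
      continuous_logLik.continuousOn
  obtain ⟨v, -, hv⟩ := hmax (2 * k * b) (by positivity)
  refine ⟨_, isMLE_sub_const (v := v) fun w => ?_⟩
  obtain ⟨w', hw'_mem, hw'⟩ := hmax ‖w - u‖ (norm_nonneg _)
  have hosc := sub_sub_sub_le_of_isMaxOn hX hM hG hexp hk hb hb1 hu hz hw'_mem hw'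
  calc logLik N X w ≤ logLik N X w' := hw' (mem_closedBall_iff_norm.2 le_rfl)
    _ = logLik N X (w' - Function.const _ (w' 0 - u 0)) := (logLik_sub_const _ _).symm
    _ ≤ logLik N X v := hv (mem_closedBall_iff_norm.2 ?_)
  refine (pi_norm_le_iff_of_nonneg (by positivity)).2 fun i => abs_le.2 ?_
  have hi := hosc i 0
  have hi' := hosc 0 i
  simp only [Pi.sub_apply, Function.const_apply]
  constructor <;> linarith

theorem mleUniqueWithin_of_hasExpansion (hX : ∀ e t, X e t = 1 ∨ X e t = -1)
    (hM : ∀ e : Pair n, |relScore u e| ≤ M) (hG : 0 ≤ G) (hexp : HasExpansion N G L) (hL : 0 < L)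
    (hk : n < 2 * G ^ k) (hb : 0 ≤ b) (hb1 : b ≤ 1)
    (hu : ∀ i, |scoreForm N X u (Pi.single i 1)| ≤ z) (hz : z < minCurvature M * b * L)
    (hu0 : FirstZero u) : MLEUniqueWithin N X u (2 * k * b) := by
  obtain ⟨v, hv⟩ := exists_isMLE hX hM hG hexp hk hb hb1 hu hz
  exact ⟨⟨v, hv, fun w hw => hw.eq_of_hasExpansion hX hG hexp hL hk hv⟩,
    fun w hw => hw.norm_sub_le hX hM hG hexp hk hb hb1 hu hz hu0⟩

end Expansion

/-! ### Concentration of sums of independent bounded variables -/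

section Chernoff

variable {Ω : Type*} [MeasurableSpace Ω] {μ : Measure Ω} [IsProbabilityMeasure μ]

lemma measureReal_le_sum_le_exp_of_mgf_le {ι : Type*} {Y : ι → Ω → ℝ} {B c : ι → ℝ} {s : ℝ}
    (hind : iIndepFun Y μ) (hmeas : ∀ i, AEMeasurable (Y i) μ)
    (hB : ∀ i, ∀ᵐ ω ∂μ, |Y i ω| ≤ B i) (hs : 0 ≤ s) {P : Finset ι}
    (hmgf : ∀ i ∈ P, mgf (Y i) μ s ≤ Real.exp (c i)) (z : ℝ) :
    μ.real {ω | z ≤ ∑ i ∈ P, Y i ω} ≤ Real.exp (∑ i ∈ P, c i - s * z) := by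
  have hint : Integrable (fun ω => Real.exp (s * (∑ i ∈ P, Y i) ω)) μ := by
    refine integrable_exp_mul_of_mem_Icc (a := -∑ i ∈ P, B i) (b := ∑ i ∈ P, B i)
      (Finset.aemeasurable_sum P fun i _ => hmeas i) ?_
    filter_upwards [(ae_ball_iff P.countable_toSet).2 fun i _ => hB i] with ω hω
    rw [Set.mem_Icc, ← abs_le, Finset.sum_apply]
    exact (Finset.abs_sum_le_sum_abs _ _).trans (Finset.sum_le_sum hω)
  simp only [← Finset.sum_apply]
  calc _ ≤ Real.exp (-s * z) * mgf (∑ i ∈ P, Y i) μ s := measure_ge_le_exp_mul_mgf z hs hint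
    _ = Real.exp (-s * z) * ∏ i ∈ P, mgf (Y i) μ s := by rw [hind.mgf_sum₀ hmeas]
    _ ≤ Real.exp (-s * z) * ∏ i ∈ P, Real.exp (c i) := by
        gcongr with i hi
        · exact fun _ _ => mgf_nonneg
        · exact hmgf i hi
    _ = _ := by
        rw [← Real.exp_sum, ← Real.exp_add]
        ring_nf

-- Bernstein's trick: `exp x ≤ 1 + x + x ^ 2` on `[-1, 1]`.
lemma mgf_le_exp_sq_mul_integral_sq {Y : Ω → ℝ} {B s : ℝ} (hmeas : AEMeasurable Y μ)
    (hB : ∀ᵐ ω ∂μ, |Y ω| ≤ B) (hmean : ∫ ω, Y ω ∂μ = 0) (hs : |s| * B ≤ 1) :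
    mgf Y μ s ≤ Real.exp (s ^ 2 * ∫ ω, Y ω ^ 2 ∂μ) := by
  have hint : Integrable Y μ := .of_bound hmeas.aestronglyMeasurable B hB
  have hint_sq : Integrable (fun ω => Y ω ^ 2) μ := by
    refine .of_bound (hmeas.pow_const 2).aestronglyMeasurable (B ^ 2) ?_
    filter_upwards [hB] with ω hω
    rw [norm_pow, Real.norm_eq_abs]
    gcongr
  have hint_add : Integrable (fun ω => s * Y ω + s ^ 2 * Y ω ^ 2) μ :=
    (hint.const_mul s).add (hint_sq.const_mul (s ^ 2))
  have hexp : ∀ᵐ ω ∂μ, Real.exp (s * Y ω) ≤ 1 + (s * Y ω + s ^ 2 * Y ω ^ 2) := by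
    filter_upwards [hB] with ω hω
    have hsmall : |s * Y ω| ≤ 1 := by
      rw [abs_mul]
      exact (by gcongr : |s| * |Y ω| ≤ |s| * B).trans hs
    have := (abs_le.1 (Real.abs_exp_sub_one_sub_id_le hsmall)).2
    rw [mul_pow] at this
    linarith
  have hint_exp : Integrable (fun ω => Real.exp (s * Y ω)) μ :=
    integrable_exp_mul_of_mem_Icc hmeas (hB.mono fun ω hω => Set.mem_Icc.2 (abs_le.1 hω))
  calc mgf Y μ s ≤ ∫ ω, 1 + (s * Y ω + s ^ 2 * Y ω ^ 2) ∂μ :=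
        integral_mono_ae hint_exp ((integrable_const 1).add hint_add) hexp
    _ = s ^ 2 * ∫ ω, Y ω ^ 2 ∂μ + 1 := by
        rw [integral_add (integrable_const 1) hint_add,
          integral_add (hint.const_mul s) (hint_sq.const_mul (s ^ 2)), integral_const_mul,
          integral_const_mul, hmean, integral_const, probReal_univ, one_smul]
        ring
    _ ≤ _ := Real.add_one_le_exp _

end Chernoff

lemma iIndepFun_curry {Ω ι : Type*} {κ : ι → Type*} [MeasurableSpace Ω] {μ : Measure Ω}
    [IsProbabilityMeasure μ] [Countable ι] [∀ i, Countable (κ i)] {𝓧 : (i : ι) → κ i → Type*}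
    [∀ i j, MeasurableSpace (𝓧 i j)] {X : (i : ι) → (j : κ i) → Ω → 𝓧 i j}
    (hmeas : ∀ i j, AEMeasurable (X i j) μ)
    (hind : iIndepFun (fun (q : (i : ι) × κ i) ω => X q.1 q.2 ω) μ) :
    iIndepFun (fun i ω j => X i j ω) μ := by
  have (i : ι) (j : κ i) : IsProbabilityMeasure (μ.map (X i j)) :=
    Measure.isProbabilityMeasure_map (hmeas i j)
  have hrow_law (i : ι) :
      μ.map (fun ω j => X i j ω) = Measure.infinitePi fun j => μ.map (X i j) :=
    (hind.precomp (g := fun j : κ i => (⟨i, j⟩ : (i : ι) × κ i))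
      sigma_mk_injective).map_fun_eq_infinitePi_map₀' (hmeas i)
  rw [iIndepFun_iff_map_fun_eq_infinitePi_map₀' fun i => aemeasurable_pi_iff.2 (hmeas i)]
  simp_rw [hrow_law]
  rw [← Measure.infinitePi_map_piCurry (fun i j => μ.map (X i j)),
    ← hind.map_fun_eq_infinitePi_map₀' fun q => hmeas q.1 q.2,
    AEMeasurable.map_map_of_aemeasurable (MeasurableEquiv.measurable _).aemeasurable
      (aemeasurable_pi_iff.2 fun q => hmeas q.1 q.2)]
  rfl

/-! ### Laws of the counts and outcomes -/

section Laws

lemma ae_tmLaw (y : ℝ) : ∀ᵐ x ∂tmLaw y, x = 1 ∨ x = -1 := by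
  rw [tmLaw, ae_add_measure_iff]
  constructor <;> refine Measure.ae_smul_measure ?_ _ <;> rw [ae_dirac_iff .of_discrete] <;> simp

lemma integral_tmLaw (y : ℝ) (F : ℤ → ℝ) :
    ∫ x, F x ∂tmLaw y = probit y * F 1 + probit (-y) * F (-1) := by
  have hint (c : ℝ) (x : ℤ) : Integrable F (ENNReal.ofReal c • Measure.dirac x) :=
    (integrable_dirac (by simp)).smul_measure (by simp)
  rw [tmLaw, integral_add_measure (hint _ _) (hint _ _), integral_smul_measure,
    integral_smul_measure, integral_dirac, integral_dirac, tmMass_one, tmMass_neg_one,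
    ENNReal.toReal_ofReal (probit_nonneg _), ENNReal.toReal_ofReal (probit_nonneg _),
    smul_eq_mul, smul_eq_mul]

lemma integral_score_tmLaw (y : ℝ) : ∫ x, score x y ∂tmLaw y = 0 := by
  rw [integral_tmLaw, score_one, score_neg_one, invMills, invMills, mul_neg,
    mul_div_cancel₀ _ (probit_pos _).ne', mul_div_cancel₀ _ (probit_pos _).ne',
    normalDensity_neg, add_neg_cancel]

variable {Ω : Type*} [MeasurableSpace Ω] {μ : Measure Ω} {T : ℕ} {p : unitInterval} {K : Ω → ℕ}

lemma measureReal_pos_of_hasLaw_binomial (hK : HasLaw K (binomial T p) μ) :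
    μ.real {ω | 0 < K ω} = 1 - (1 - (p : ℝ)) ^ T := by
  rw [hK.measureReal_eq (p := fun k => 0 < k) .of_discrete, ← binomial_real_zero T p,
    ← probReal_compl_eq_one_sub .of_discrete]
  congr 1
  ext k
  simp [Nat.pos_iff_ne_zero]

lemma le_measureReal_pos_of_hasLaw_binomial [NeZero T] (hK : HasLaw K (binomial T p) μ) :
    (p : ℝ) ≤ μ.real {ω | 0 < K ω} := by
  rw [measureReal_pos_of_hasLaw_binomial hK]
  have := pow_le_of_le_one (sub_nonneg.2 p.2.2) (sub_le_self 1 p.2.1) (NeZero.ne T)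
  linarith

lemma measureReal_pos_le_of_hasLaw_binomial (hK : HasLaw K (binomial T p) μ) :
    μ.real {ω | 0 < K ω} ≤ T * p := by
  rw [measureReal_pos_of_hasLaw_binomial hK, sub_eq_add_neg 1 (p : ℝ)]
  have := one_add_mul_le_pow (a := -(p : ℝ)) (by linarith [p.2.2]) T
  linarith

lemma integral_indicator_pos_of_hasLaw_binomial (hK : HasLaw K (binomial T p) μ) :
    ∫ ω, {k : ℕ | 0 < k}.indicator (1 : ℕ → ℝ) (K ω) ∂μ = μ.real {ω | 0 < K ω} := by
  rw [hK.measureReal_eq (p := fun k => 0 < k) .of_discrete]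
  exact (hK.integral_comp Measurable.of_discrete.aestronglyMeasurable).trans
    (integral_indicator_one .of_discrete)

lemma mgf_neg_indicator_pos_le_of_hasLaw_binomial [IsProbabilityMeasure μ] [NeZero T]
    (hK : HasLaw K (binomial T p) μ) :
    mgf (fun ω => -{k : ℕ | 0 < k}.indicator (1 : ℕ → ℝ) (K ω)) μ 1 ≤
      Real.exp (-(p : ℝ) / 2) := by
  set I : Ω → ℝ := fun ω => {k : ℕ | 0 < k}.indicator 1 (K ω)
  have hint : Integrable I μ :=
    .of_bound ((Measurable.of_discrete (f := {k : ℕ | 0 < k}.indicator 1)).comp_aemeasurable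
      hK.aemeasurable).aestronglyMeasurable 1
      (ae_of_all _ fun ω => by by_cases h : 0 < K ω <;> simp [I, h])
  have hexp (ω : Ω) : Real.exp (1 * -I ω) = 1 - (1 - Real.exp (-1)) * I ω := by
    by_cases h : 0 < K ω <;> simp [I, h]
  have hhalf : Real.exp (-1) ≤ 1 / 2 := by
    have := Real.exp_neg_one_lt_half
    linarith
  calc mgf (fun ω => -I ω) μ 1 = 1 - (1 - Real.exp (-1)) * μ.real {ω | 0 < K ω} := by
        simp only [mgf, hexp]
        rw [integral_sub (integrable_const _) (hint.const_mul _), integral_const_mul,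
          integral_indicator_pos_of_hasLaw_binomial hK, integral_const, probReal_univ, one_smul]
    _ ≤ -(p : ℝ) / 2 + 1 := by
        nlinarith [p.2.1, le_measureReal_pos_of_hasLaw_binomial hK]
    _ ≤ _ := Real.add_one_le_exp _

end Laws

/-! ### Concentration for comparison data -/

section Concentration

variable {T n : ℕ}

/-- The derivative at relative score `y` of the log-likelihood of `k` comparisons of one pair with
outcomes `x 0, x 1, …`. -/
def pairScore (y : ℝ) (k : ℕ) (x : Fin T → ℤ) : ℝ :=
  ∑ t : Fin T, if (t : ℕ) < k then score (x t) y else 0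

lemma scoreForm_eq_sum_pairScore (N : Pair n → ℕ) (X : Pair n → Fin T → ℤ) (u w : Fin n → ℝ) :
    scoreForm N X u w = ∑ e, pairScore (relScore u e) (N e) (X e) * relScore w e := by
  simp only [scoreForm_apply, pairScore, Finset.sum_mul, ite_mul, zero_mul]

lemma abs_pairScore_le {M y : ℝ} (hy : |y| ≤ M) (k : ℕ) (x : Fin T → ℤ) :
    |pairScore y k x| ≤ T * Real.exp (M + 1 / 2) := by
  calc _ ≤ ∑ t : Fin T, |if (t : ℕ) < k then score (x t) y else 0| :=
        Finset.abs_sum_le_sum_abs _ _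
    _ ≤ ∑ _t : Fin T, Real.exp (M + 1 / 2) := by
        gcongr with t
        split_ifs
        · exact abs_score_le _ hy
        · rw [abs_zero]
          positivity
    _ = _ := by simp

lemma pairScore_sq_le {M y : ℝ} (hy : |y| ≤ M) (k : ℕ) (x : Fin T → ℤ) :
    pairScore y k x ^ 2 ≤
      (T * Real.exp (M + 1 / 2)) ^ 2 * {k : ℕ | 0 < k}.indicator (1 : ℕ → ℝ) k := by
  obtain rfl | hk := k.eq_zero_or_pos
  · simp [pairScore]
  · simpa [hk] using sq_le_sq.2 ((abs_pairScore_le hy k x).trans (le_abs_self _))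

lemma sum_sq_relScore_le (w : Fin n → ℝ) : ∑ e, relScore w e ^ 2 ≤ 2 * n * ∑ i, w i ^ 2 := by
  calc _ = ∑ q ∈ Finset.univ.map (Function.Embedding.subtype fun q : Fin n × Fin n => q.1 < q.2),
          (w q.1 - w q.2) ^ 2 := (Finset.sum_map _ _ _).symm
    _ ≤ ∑ q : Fin n × Fin n, (w q.1 - w q.2) ^ 2 :=
        Finset.sum_le_univ_sum_of_nonneg fun _ => sq_nonneg _
    _ = 2 * n * ∑ i, w i ^ 2 - 2 * (∑ i, w i) ^ 2 := by
        simp only [sub_sq, Fintype.sum_prod_type, Finset.sum_add_distrib, Finset.sum_sub_distrib,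
          Finset.sum_const, Finset.card_univ, Fintype.card_fin, nsmul_eq_mul, ← Finset.mul_sum,
          ← Finset.sum_mul]
        ring
    _ ≤ _ := sub_le_self _ (by positivity)

variable {Ω : Type*} [MeasurableSpace Ω] {μ : Measure Ω} {p : unitInterval} {u : Fin n → ℝ}
  {N : Pair n → Ω → ℕ} {X : Pair n → Fin T → Ω → ℤ}

lemma IsTMData.ae_outcome (h : IsTMData μ T p u N X) :
    ∀ᵐ ω ∂μ, ∀ e t, X e t ω = 1 ∨ X e t ω = -1 :=
  ae_all_iff.2 fun e => ae_all_iff.2 fun t =>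
    ((h.law_outcome e t).ae_iff (p := fun x => x = 1 ∨ x = -1) .of_discrete).2 (ae_tmLaw _)

lemma IsTMData.aemeasurable (h : IsTMData μ T p u N X) (q : Pair n ⊕ (Pair n × Fin T)) :
    AEMeasurable (Sum.elim (fun e ω => (N e ω : ℤ)) (fun q ω => X q.1 q.2 ω) q) μ := by
  obtain e | q := q
  · exact Measurable.of_discrete.comp_aemeasurable (h.law_count e).aemeasurable
  · exact (h.law_outcome q.1 q.2).aemeasurable

lemma IsTMData.aemeasurable_pairScore (h : IsTMData μ T p u N X) (y : ℝ) (e : Pair n) :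
    AEMeasurable (fun ω => pairScore y (N e ω) fun t => X e t ω) μ :=
  (Measurable.of_discrete (f := fun q : ℕ × (Fin T → ℤ) => pairScore y q.1 q.2)).comp_aemeasurable
    ((h.law_count e).aemeasurable.prodMk
      (aemeasurable_pi_iff.2 fun t => (h.law_outcome e t).aemeasurable))

lemma IsTMData.iIndepFun_count (h : IsTMData μ T p u N X) : iIndepFun N μ := by
  have := (h.indep.precomp (g := Sum.inl) Sum.inl_injective).comp (fun _ k => k.toNat)
    fun _ => .of_discrete
  exact this

lemma IsTMData.indepFun_count_outcome (h : IsTMData μ T p u N X) (e : Pair n) (t : Fin T) :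
    IndepFun (N e) (X e t) μ := by
  have := (h.indep.indepFun (i := Sum.inl e) (j := Sum.inr (e, t)) (by simp)).comp
    (φ := Int.toNat) (ψ := id) .of_discrete .of_discrete
  exact this

variable [IsProbabilityMeasure μ]

lemma IsTMData.iIndepFun_pairScore (h : IsTMData μ T p u N X) (y : Pair n → ℝ) :
    iIndepFun (fun e ω => pairScore (y e) (N e ω) fun t => X e t ω) μ := by
  let row (q : (_ : Pair n) × Option (Fin T)) : Pair n ⊕ (Pair n × Fin T) :=
    q.2.elim (Sum.inl q.1) fun t => Sum.inr (q.1, t)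
  have hrow : Function.Injective row := by
    rintro ⟨e, _ | t⟩ ⟨e', _ | t'⟩ hq <;> simp_all [row]
  have := (iIndepFun_curry (fun e s => h.aemeasurable (row ⟨e, s⟩)) (h.indep.precomp hrow)).comp
    (fun e (r : Option (Fin T) → ℤ) => pairScore (y e) (r none).toNat fun t => r (some t))
    fun _ => .of_discrete
  exact this

lemma IsTMData.integral_pairScore (h : IsTMData μ T p u N X) (e : Pair n) :
    ∫ ω, pairScore (relScore u e) (N e ω) (fun t => X e t ω) ∂μ = 0 := by
  set y := relScore u e
  have hscore (t : Fin T) : ∫ ω, score (X e t ω) y ∂μ = 0 :=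
    ((h.law_outcome e t).integral_comp (f := fun x => score x y)
      Measurable.of_discrete.aestronglyMeasurable).trans (integral_score_tmLaw y)
  have hmeas_observed (t : Fin T) : AEStronglyMeasurable
      (fun ω => {k : ℕ | (t : ℕ) < k}.indicator (1 : ℕ → ℝ) (N e ω)) μ :=
    ((Measurable.of_discrete (f := {k : ℕ | (t : ℕ) < k}.indicator 1)).comp_aemeasurable
      (h.law_count e).aemeasurable).aestronglyMeasurable
  have hmeas_score (t : Fin T) : AEStronglyMeasurable (fun ω => score (X e t ω) y) μ :=
    ((Measurable.of_discrete (f := fun x => score x y)).comp_aemeasurable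
      (h.law_outcome e t).aemeasurable).aestronglyMeasurable
  have hsplit (ω : Ω) : pairScore y (N e ω) (fun t => X e t ω) =
      ∑ t : Fin T, {k : ℕ | (t : ℕ) < k}.indicator (1 : ℕ → ℝ) (N e ω) * score (X e t ω) y := by
    simp [pairScore, Set.indicator_apply]
  simp_rw [hsplit]
  rw [integral_finsetSum]
  · refine Finset.sum_eq_zero fun t _ => ?_
    have hind := (h.indepFun_count_outcome e t).comp
      (φ := {k : ℕ | (t : ℕ) < k}.indicator (1 : ℕ → ℝ)) (ψ := fun x => score x y)
      .of_discrete .of_discrete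
    exact (hind.integral_fun_mul_eq_mul_integral (hmeas_observed t) (hmeas_score t)).trans
      (mul_eq_zero_of_right _ (hscore t))
  · intro t _
    refine .of_bound ((hmeas_observed t).mul (hmeas_score t)) (Real.exp (|y| + 1 / 2))
      (ae_of_all _ fun ω => ?_)
    rw [norm_mul, Real.norm_eq_abs (score _ _)]
    refine (mul_le_of_le_one_left (abs_nonneg _) ?_).trans (abs_score_le _ le_rfl)
    exact (norm_indicator_le_norm_self (1 : ℕ → ℝ) _).trans_eq norm_one

lemma IsTMData.integral_pairScore_sq_le {M : ℝ} (h : IsTMData μ T p u N X) {e : Pair n}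
    (hM : |relScore u e| ≤ M) :
    ∫ ω, pairScore (relScore u e) (N e ω) (fun t => X e t ω) ^ 2 ∂μ ≤
      T ^ 3 * p * Real.exp (M + 1 / 2) ^ 2 := by
  have hmeas_compared : AEStronglyMeasurable
      (fun ω => {k : ℕ | 0 < k}.indicator (1 : ℕ → ℝ) (N e ω)) μ :=
    ((Measurable.of_discrete (f := {k : ℕ | 0 < k}.indicator 1)).comp_aemeasurable
      (h.law_count e).aemeasurable).aestronglyMeasurable
  have hint : Integrable (fun ω => (T * Real.exp (M + 1 / 2)) ^ 2 *
      {k : ℕ | 0 < k}.indicator (1 : ℕ → ℝ) (N e ω)) μ :=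
    .const_mul (.of_bound hmeas_compared 1
      (ae_of_all _ fun ω => (norm_indicator_le_norm_self (1 : ℕ → ℝ) _).trans_eq norm_one)) _
  calc _ ≤ ∫ ω, (T * Real.exp (M + 1 / 2)) ^ 2 *
          {k : ℕ | 0 < k}.indicator (1 : ℕ → ℝ) (N e ω) ∂μ :=
        integral_mono_of_nonneg (ae_of_all _ fun ω => sq_nonneg _) hint
          (ae_of_all _ fun ω => pairScore_sq_le hM _ _)
    _ = (T * Real.exp (M + 1 / 2)) ^ 2 * μ.real {ω | 0 < N e ω} := by
        rw [integral_const_mul, integral_indicator_pos_of_hasLaw_binomial (h.law_count e)]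
    _ ≤ (T * Real.exp (M + 1 / 2)) ^ 2 * (T * p) := by
        gcongr
        exact measureReal_pos_le_of_hasLaw_binomial (h.law_count e)
    _ = _ := by ring

lemma IsTMData.measureReal_le_scoreForm_le {M s : ℝ} {w : Fin n → ℝ} (h : IsTMData μ T p u N X)
    (hM : ∀ e, |relScore u e| ≤ M) (hs : 0 ≤ s)
    (hsw : ∀ e, s * (T * Real.exp (M + 1 / 2) * |relScore w e|) ≤ 1) (z : ℝ) :
    μ.real {ω | z ≤ scoreForm (fun e => N e ω) (fun e t => X e t ω) u w} ≤
      Real.exp (2 * T ^ 3 * (n * p) * (s * Real.exp (M + 1 / 2)) ^ 2 * ∑ i, w i ^ 2 - s * z) := by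
  let Y (e : Pair n) (ω : Ω) : ℝ :=
    pairScore (relScore u e) (N e ω) (fun t => X e t ω) * relScore w e
  have hmeas (e : Pair n) : AEMeasurable (Y e) μ := (h.aemeasurable_pairScore _ e).mul_const _
  have hbound (e : Pair n) :
      ∀ᵐ ω ∂μ, |Y e ω| ≤ T * Real.exp (M + 1 / 2) * |relScore w e| :=
    ae_of_all _ fun ω => by
      rw [abs_mul]
      gcongr
      exact abs_pairScore_le (hM e) _ _
  have hmean (e : Pair n) : ∫ ω, Y e ω ∂μ = 0 := by
    rw [integral_mul_const, h.integral_pairScore, zero_mul]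
  have hsq (e : Pair n) :
      ∫ ω, Y e ω ^ 2 ∂μ ≤ T ^ 3 * p * Real.exp (M + 1 / 2) ^ 2 * relScore w e ^ 2 := by
    simp only [Y, mul_pow]
    rw [integral_mul_const]
    gcongr
    exact h.integral_pairScore_sq_le (hM e)
  have hmgf (e : Pair n) : mgf (Y e) μ s ≤
      Real.exp (s ^ 2 * (T ^ 3 * p * Real.exp (M + 1 / 2) ^ 2 * relScore w e ^ 2)) := by
    refine (mgf_le_exp_sq_mul_integral_sq (hmeas e) (hbound e) (hmean e) ?_).trans ?_
    · rw [abs_of_nonneg hs]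
      exact hsw e
    · gcongr
      exact hsq e
  have hind : iIndepFun Y μ :=
    (h.iIndepFun_pairScore (relScore u)).comp (fun e x => x * relScore w e)
      fun e => measurable_id.mul_const _
  simp_rw [scoreForm_eq_sum_pairScore]
  refine (measureReal_le_sum_le_exp_of_mgf_le hind hmeas hbound hs (fun e _ => hmgf e) z).trans ?_
  gcongr
  have hp : (0 : ℝ) ≤ p := p.2.1
  calc _ = s ^ 2 * (T ^ 3 * p * Real.exp (M + 1 / 2) ^ 2) * ∑ e, relScore w e ^ 2 := by
        simp only [Finset.mul_sum, mul_assoc]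
    _ ≤ s ^ 2 * (T ^ 3 * p * Real.exp (M + 1 / 2) ^ 2) * (2 * n * ∑ i, w i ^ 2) := by
        gcongr
        exact sum_sq_relScore_le w
    _ = _ := by ring

lemma IsTMData.measureReal_card_filter_pos_le [NeZero T] (h : IsTMData μ T p u N X)
    (P : Finset (Pair n)) (x : ℝ) :
    μ.real {ω | ((P.filter fun e => 0 < N e ω).card : ℝ) ≤ x} ≤
      Real.exp (x - p * P.card / 2) := by
  let Y (e : Pair n) (ω : Ω) : ℝ := -{k : ℕ | 0 < k}.indicator (1 : ℕ → ℝ) (N e ω)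
  have hcard (ω : Ω) :
      ((P.filter fun e => 0 < N e ω).card : ℝ) ≤ x ↔ -x ≤ ∑ e ∈ P, Y e ω := by
    simp [Y, Set.indicator_apply, Finset.sum_neg_distrib]
  have hY : Measurable fun k : ℕ => -{k : ℕ | 0 < k}.indicator (1 : ℕ → ℝ) k := .of_discrete
  simp_rw [hcard]
  refine (measureReal_le_sum_le_exp_of_mgf_le (B := fun _ => 1)
    (h.iIndepFun_count.comp _ fun _ => hY)
    (fun e => hY.comp_aemeasurable (h.law_count e).aemeasurable) (fun e => ae_of_all _ fun ω => ?_)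
    zero_le_one (fun e _ => mgf_neg_indicator_pos_le_of_hasLaw_binomial (h.law_count e))
    _).trans_eq ?_
  · rw [Function.comp_apply, abs_neg]
    exact (norm_indicator_le_norm_self (1 : ℕ → ℝ) _).trans_eq norm_one
  · rw [Finset.sum_const, nsmul_eq_mul]
    ring_nf

end Concentration

/-! ### Vertex expansion with high probability -/

section RandomExpansion

variable {T n : ℕ}

lemma card_mul_card_le_card_cutPairs {A D : Finset (Fin n)} (h : Disjoint A D) :
    A.card * D.card ≤ (cutPairs A D).card := by
  rw [← Finset.card_product]
  refine Finset.card_le_card_of_surjOn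
    (fun e : Pair n => if e.1.1 ∈ A then (e.1.1, e.1.2) else (e.1.2, e.1.1)) ?_
  rintro ⟨a, d⟩ hq
  obtain ⟨ha, hd⟩ := Finset.mem_product.1 (Finset.mem_coe.1 hq)
  obtain hlt | hlt := lt_or_gt_of_ne (Finset.disjoint_iff_ne.1 h a ha d hd)
  · exact ⟨⟨(a, d), hlt⟩, by simp [cutPairs, ha, hd], by simp [ha]⟩
  · exact ⟨⟨(d, a), hlt⟩, by simp [cutPairs, ha, hd], by simp [Finset.disjoint_right.1 h hd]⟩

lemma card_mul_half_le_card_cutPairs_compl {A A' : Finset (Fin n)} (hsub : A ⊆ A')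
    (hhalf : 2 * A'.card ≤ n) : (A.card : ℝ) * (n / 2) ≤ (cutPairs A A'ᶜ).card := by
  have hcompl : (n : ℝ) / 2 ≤ (A'ᶜ.card : ℝ) := by
    have hcard : A'ᶜ.card = n - A'.card := by rw [Finset.card_compl, Fintype.card_fin]
    rw [div_le_iff₀ two_pos]
    exact_mod_cast (by omega : n ≤ A'ᶜ.card * 2)
  calc (A.card : ℝ) * (n / 2) ≤ A.card * A'ᶜ.card := by gcongr
    _ ≤ _ := mod_cast card_mul_card_le_card_cutPairs (disjoint_compl_right.mono_left hsub)

lemma sum_pow_card_le_exp {x : ℝ} (hx : 0 ≤ x) :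
    ∑ A : Finset (Fin n), x ^ A.card ≤ Real.exp (n * x) :=
  calc ∑ A : Finset (Fin n), x ^ A.card = (x + 1) ^ n := by
        simpa using Fin.sum_pow_mul_eq_add_pow (n := n) x 1
    _ ≤ Real.exp x ^ n := by
        gcongr
        exact Real.add_one_le_exp x
    _ = Real.exp (n * x) := (Real.exp_nat_mul x n).symm

variable [NeZero T] {Ω : Type*} [MeasurableSpace Ω] {μ : Measure Ω} [IsProbabilityMeasure μ]
  {p : unitInterval} {u : Fin n → ℝ} {N : Pair n → Ω → ℕ} {X : Pair n → Fin T → Ω → ℤ}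

lemma IsTMData.measureReal_card_comparedPairs_lt_le (h : IsTMData μ T p u N X)
    {A A' : Finset (Fin n)} (hA : A.Nonempty) (hsub : A ⊆ A') (hhalf : 2 * A'.card ≤ n)
    (hgrowth : (A'.card : ℝ) ≤ n * p / (64 * Real.log n) * A.card) :
    μ.real {ω | ((comparedPairs (fun e => N e ω) A A'ᶜ).card : ℝ) < n * p / 8 * A.card} ≤
      (1 / (n : ℝ)) ^ 6 * ((1 / (n : ℝ)) ^ A.card * (1 / (n : ℝ)) ^ A'.card) := by
  have hApos : 0 < A.card := hA.card_pos
  have hAA' := Finset.card_le_card hsub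
  have hn : 1 < n := by omega
  have hlog : 0 < Real.log n := Real.log_pos (by exact_mod_cast hn)
  have hcut := mul_le_mul_of_nonneg_left (card_mul_half_le_card_cutPairs_compl hsub hhalf) p.2.1
  rw [div_mul_eq_mul_div, le_div_iff₀ (by positivity)] at hgrowth
  calc _ ≤ μ.real {ω | (((cutPairs A A'ᶜ).filter fun e => 0 < N e ω).card : ℝ) ≤
          n * p / 8 * A.card} := by
        refine measureReal_mono fun ω hω => ?_
        rw [Set.mem_ofPred_eq] at hω
        exact hω.le
    _ ≤ Real.exp (n * p / 8 * A.card - p * (cutPairs A A'ᶜ).card / 2) :=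
        h.measureReal_card_filter_pos_le _ _
    _ ≤ Real.exp ((8 * A'.card : ℕ) * -Real.log n) := by
        gcongr
        push_cast
        linarith
    _ = (1 / (n : ℝ)) ^ (8 * A'.card) := by
        rw [Real.exp_nat_mul, Real.exp_neg, Real.exp_log (by positivity), one_div]
    _ ≤ (1 / (n : ℝ)) ^ (6 + (A.card + A'.card)) := by
        refine pow_le_pow_of_le_one (by positivity) ?_ (by omega)
        exact div_le_one_of_le₀ (by exact_mod_cast hn.le) (by positivity)
    _ = _ := by rw [pow_add, pow_add]

lemma IsTMData.measureReal_not_hasExpansion_le (h : IsTMData μ T p u N X) :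
    μ.real {ω | ¬ HasExpansion (fun e => N e ω) (n * p / (64 * Real.log n)) (n * p / 8)} ≤
      9 / (n : ℝ) ^ 6 := by
  let bad (q : Finset (Fin n) × Finset (Fin n)) : Set Ω :=
    {ω | (q.1.Nonempty ∧ q.1 ⊆ q.2 ∧ 2 * q.2.card ≤ n ∧
        (q.2.card : ℝ) ≤ n * p / (64 * Real.log n) * q.1.card) ∧
      ((comparedPairs (fun e => N e ω) q.1 q.2ᶜ).card : ℝ) < n * p / 8 * q.1.card}
  have hcover : {ω | ¬ HasExpansion (fun e => N e ω) (n * p / (64 * Real.log n)) (n * p / 8)} ⊆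
      ⋃ q, bad q := by
    intro ω hω
    simp only [HasExpansion, Set.mem_ofPred_eq, not_forall, not_le] at hω
    obtain ⟨A, A', hA, hsub, hhalf, hgrowth, hlt⟩ := hω
    exact Set.mem_iUnion.2 ⟨(A, A'), ⟨hA, hsub, hhalf, hgrowth⟩, hlt⟩
  have hbad (q : Finset (Fin n) × Finset (Fin n)) : μ.real (bad q) ≤
      (1 / (n : ℝ)) ^ 6 * ((1 / (n : ℝ)) ^ q.1.card * (1 / (n : ℝ)) ^ q.2.card) := by
    by_cases hq : q.1.Nonempty ∧ q.1 ⊆ q.2 ∧ 2 * q.2.card ≤ n ∧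
        (q.2.card : ℝ) ≤ n * p / (64 * Real.log n) * q.1.card
    · exact (measureReal_mono fun ω hω => hω.2).trans
        (h.measureReal_card_comparedPairs_lt_le hq.1 hq.2.1 hq.2.2.1 hq.2.2.2)
    · rw [Set.eq_empty_of_forall_notMem (s := bad q) fun ω hω => hq hω.1, measureReal_empty]
      positivity
  have hexp : ∑ A : Finset (Fin n), (1 / (n : ℝ)) ^ A.card ≤ Real.exp 1 := by
    refine (sum_pow_card_le_exp (by positivity)).trans (Real.exp_le_exp.2 ?_)
    rw [mul_one_div]
    exact div_self_le_one _
  calc _ ≤ ∑ q, μ.real (bad q) := (measureReal_mono hcover).trans (measureReal_iUnion_fintype_le _)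
    _ ≤ ∑ q : Finset (Fin n) × Finset (Fin n),
          (1 / (n : ℝ)) ^ 6 * ((1 / (n : ℝ)) ^ q.1.card * (1 / (n : ℝ)) ^ q.2.card) :=
        Finset.sum_le_sum fun q _ => hbad q
    _ = (1 / (n : ℝ)) ^ 6 * (∑ A : Finset (Fin n), (1 / (n : ℝ)) ^ A.card) ^ 2 := by
        rw [← Finset.mul_sum, Fintype.sum_prod_type, sq, Finset.sum_mul_sum]
    _ ≤ (1 / (n : ℝ)) ^ 6 * 9 := by
        gcongr
        calc _ ≤ Real.exp 1 ^ 2 := by gcongr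
          _ ≤ 3 ^ 2 := by
            gcongr
            exact Real.exp_one_lt_three.le
          _ = 9 := by norm_num
    _ = 9 / (n : ℝ) ^ 6 := by ring

end RandomExpansion

/-! ### Concentration of the score vector -/

section FiniteSample

variable {T n : ℕ}

/-- A bound for the entries of the score vector at true scores of dynamic range `M`, exceeded only
with small probability. Its order in `n` and `p` is that of the standard deviation times
`sqrt (log n)`. -/
def scoreBound (T n : ℕ) (p M : ℝ) : ℝ :=
  (2 * T + 4) * (T * Real.exp (M + 1 / 2)) * √(Real.log n * (n * p))

lemma abs_relScore_single_le (i : Fin n) (e : Pair n) :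
    |relScore (Pi.single i (1 : ℝ)) e| ≤ 1 := by
  simp only [relScore, Pi.single_apply]
  split_ifs <;> simp

lemma sqrt_div_mul_sqrt_mul {l x : ℝ} (hl : 0 ≤ l) (hx : 0 < x) :
    √(l / x) * √(l * x) = l := by
  rw [← Real.sqrt_mul (by positivity), div_mul_eq_mul_div, mul_left_comm, mul_div_assoc,
    mul_div_cancel_right₀ _ hx.ne', Real.sqrt_mul_self hl]

variable [NeZero T] {Ω : Type*} [MeasurableSpace Ω] {μ : Measure Ω} [IsProbabilityMeasure μ]
  {p : unitInterval} {u : Fin n → ℝ} {N : Pair n → Ω → ℕ} {X : Pair n → Fin T → Ω → ℤ}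

lemma IsTMData.measureReal_scoreBound_le_scoreForm_le {M : ℝ} {w : Fin n → ℝ}
    (h : IsTMData μ T p u N X) (hM : ∀ e, |relScore u e| ≤ M) (hn : 1 < n)
    (hnp : Real.log n ≤ n * p) (hw : ∀ e, |relScore w e| ≤ 1) (hw2 : ∑ i, w i ^ 2 ≤ 1) :
    μ.real {ω | scoreBound T n p M ≤ scoreForm (fun e => N e ω) (fun e t => X e t ω) u w} ≤
      1 / (n : ℝ) ^ 4 := by
  have hT : (0 : ℝ) < T := by exact_mod_cast NeZero.pos T
  have hlog : 0 < Real.log n := Real.log_pos (by exact_mod_cast hn)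
  have hx : 0 < (n : ℝ) * p := hlog.trans_le hnp
  set B := Real.exp (M + 1 / 2)
  set r := √(Real.log n / (n * p))
  have hB0 : 0 < B := Real.exp_pos _
  have hr1 : r ≤ 1 := Real.sqrt_le_one.2 ((div_le_one hx).2 hnp)
  have hrx : r ^ 2 * (n * p) = Real.log n := by
    rw [Real.sq_sqrt (by positivity), div_mul_cancel₀ _ hx.ne']
  have hscale : r / (T * B) * (T * B) = r := div_mul_cancel₀ _ (by positivity)
  have hbound : r / (T * B) * scoreBound T n p M = (2 * T + 4) * Real.log n := by
    calc _ = (2 * T + 4) * (r / (T * B) * (T * B) * √(Real.log n * (n * p))) := by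
          rw [scoreBound]
          ring
      _ = _ := by rw [hscale, sqrt_div_mul_sqrt_mul hlog.le hx]
  refine (h.measureReal_le_scoreForm_le (s := r / (T * B)) hM (by positivity) (fun e => ?_) _).trans
    ?_
  · rw [← mul_assoc, hscale]
    exact mul_le_one₀ hr1 (abs_nonneg _) (hw e)
  calc _ ≤ Real.exp (2 * T ^ 3 * (n * p) * (r / (T * B) * B) ^ 2 * 1 -
          r / (T * B) * scoreBound T n p M) := by gcongr
    _ = Real.exp ((4 : ℕ) * -Real.log n) := by
        congr 1
        rw [hbound]
        push_cast
        field_simp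
        linear_combination (2 * (T : ℝ)) * hrx
    _ = 1 / (n : ℝ) ^ 4 := by
        rw [Real.exp_nat_mul, Real.exp_neg, Real.exp_log (by positivity), inv_pow, one_div]

lemma IsTMData.measureReal_not_abs_scoreForm_single_le_le {M : ℝ} (h : IsTMData μ T p u N X)
    (hM : ∀ e, |relScore u e| ≤ M) (hn : 1 < n) (hnp : Real.log n ≤ n * p) :
    μ.real {ω | ¬ ∀ i, |scoreForm (fun e => N e ω) (fun e t => X e t ω) u (Pi.single i 1)| ≤
      scoreBound T n p M} ≤ 2 / (n : ℝ) ^ 3 := by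
  let large (w : Fin n → ℝ) : Set Ω :=
    {ω | scoreBound T n p M ≤ scoreForm (fun e => N e ω) (fun e t => X e t ω) u w}
  have hpos (i : Fin n) : μ.real (large (Pi.single i 1)) ≤ 1 / (n : ℝ) ^ 4 :=
    h.measureReal_scoreBound_le_scoreForm_le hM hn hnp (abs_relScore_single_le i)
      (by simp [Pi.single_apply])
  have hneg (i : Fin n) : μ.real (large (-Pi.single i 1)) ≤ 1 / (n : ℝ) ^ 4 :=
    h.measureReal_scoreBound_le_scoreForm_le hM hn hnp
      (fun e => by rw [relScore_neg, abs_neg]; exact abs_relScore_single_le i e)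
      (by simp [Pi.single_apply])
  calc _ ≤ μ.real (⋃ i : Fin n, (large (Pi.single i 1) ∪ large (-Pi.single i 1))) := by
        refine measureReal_mono fun ω hω => ?_
        simp only [Set.mem_ofPred_eq, not_forall, not_le, lt_abs, ← map_neg] at hω
        obtain ⟨i, hi⟩ := hω
        exact Set.mem_iUnion.2 ⟨i, hi.imp le_of_lt le_of_lt⟩
    _ ≤ ∑ i : Fin n, (μ.real (large (Pi.single i 1)) + μ.real (large (-Pi.single i 1))) :=
        (measureReal_iUnion_fintype_le _).trans
          (Finset.sum_le_sum fun i _ => measureReal_union_le _ _)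
    _ ≤ ∑ _i : Fin n, (1 / (n : ℝ) ^ 4 + 1 / (n : ℝ) ^ 4) :=
        Finset.sum_le_sum fun i _ => add_le_add (hpos i) (hneg i)
    _ = 2 / (n : ℝ) ^ 3 := by
        rw [Finset.sum_const, Finset.card_univ, Fintype.card_fin, nsmul_eq_mul]
        field_simp
        norm_num

lemma IsTMData.measureReal_not_mleUniqueWithin_le {b : ℝ} {k : ℕ} (h : IsTMData μ T p u N X)
    (hu : FirstZero u) (hn : 1 < n) (hnp : Real.log n ≤ n * p)
    (hk : (n : ℝ) < 2 * (n * p / (64 * Real.log n)) ^ k) (hb : 0 ≤ b) (hb1 : b ≤ 1)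
    (hz : scoreBound T n p (dynamicRange u) < minCurvature (dynamicRange u) * b * (n * p / 8)) :
    μ.real {ω | ¬ MLEUniqueWithin (fun e => N e ω) (fun e t => X e t ω) u (2 * k * b)} ≤
      14 / (n : ℝ) ^ 2 := by
  have : NeZero n := ⟨by omega⟩
  have hlog : 0 < Real.log n := Real.log_pos (by exact_mod_cast hn)
  have hx : 0 < (n : ℝ) * p := hlog.trans_le hnp
  have hM := abs_relScore_le_dynamicRange u
  let noExpansion : Set Ω :=
    {ω | ¬ HasExpansion (fun e => N e ω) (n * p / (64 * Real.log n)) (n * p / 8)}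
  let largeScore : Set Ω :=
    {ω | ¬ ∀ i, |scoreForm (fun e => N e ω) (fun e t => X e t ω) u (Pi.single i 1)| ≤
      scoreBound T n p (dynamicRange u)}
  have hsub : {ω | ¬ MLEUniqueWithin (fun e => N e ω) (fun e t => X e t ω) u (2 * k * b)} ≤ᵐ[μ]
      (noExpansion ∪ largeScore : Set Ω) := by
    filter_upwards [h.ae_outcome] with ω hX hω
    contrapose! hω
    obtain ⟨hexp, hscore⟩ := not_or.1 hω
    exact not_not.2 (mleUniqueWithin_of_hasExpansion hX hM (by positivity) (not_not.1 hexp)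
      (by positivity) hk hb hb1 (not_not.1 hscore) hz hu)
  have hn1 : (1 : ℝ) ≤ n := by exact_mod_cast hn.le
  calc _ ≤ μ.real (noExpansion ∪ largeScore) :=
        ENNReal.toReal_mono (measure_ne_top _ _) (measure_mono_ae hsub)
    _ ≤ μ.real noExpansion + μ.real largeScore := measureReal_union_le _ _
    _ ≤ 9 / (n : ℝ) ^ 6 + 2 / (n : ℝ) ^ 3 :=
        add_le_add h.measureReal_not_hasExpansion_le
          (h.measureReal_not_abs_scoreForm_single_le_le hM hn hnp)
    _ ≤ 9 / (n : ℝ) ^ 2 + 2 / (n : ℝ) ^ 2 := by gcongr <;> norm_num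
    _ ≤ 14 / (n : ℝ) ^ 2 := by
        rw [← add_div]
        gcongr
        norm_num

end FiniteSample

/-! ### The error rates -/

section Rates

lemma dynamicRange_nonneg {n : ℕ} (u : Fin n → ℝ) : 0 ≤ dynamicRange u :=
  Real.iSup_nonneg fun _ => abs_nonneg _

lemma MLEUniqueWithin.mono {T n : ℕ} {N : Pair n → ℕ} {X : Pair n → Fin T → ℤ} {u : Fin n → ℝ}
    {r s : ℝ} (h : MLEUniqueWithin N X u r) (hrs : r ≤ s) : MLEUniqueWithin N X u s :=
  ⟨h.1, fun v hv => (h.2 v hv).trans hrs⟩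

lemma exp_sq_le {M : ℝ} (hM : 0 ≤ M) :
    Real.exp (M ^ 2) ≤ Real.exp 1 * (M * Real.exp (M ^ 2) + 1) := by
  obtain h | h := le_total M 1
  · calc Real.exp (M ^ 2) ≤ Real.exp 1 := Real.exp_le_exp.2 (pow_le_one₀ hM h)
      _ ≤ _ := le_mul_of_one_le_right (by positivity) (le_add_of_nonneg_left (by positivity))
  · calc Real.exp (M ^ 2) ≤ M * Real.exp (M ^ 2) := le_mul_of_one_le_left (by positivity) h
      _ ≤ M * Real.exp (M ^ 2) + 1 := by linarith
      _ ≤ _ := le_mul_of_one_le_left (by positivity) (Real.one_le_exp zero_le_one)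

lemma minCurvature_mul_two_pi (M : ℝ) :
    minCurvature M * (2 * Real.pi) = Real.exp (-((M + 3) ^ 2) / 2) := by
  have hsqrt : √(2 * Real.pi) ^ 2 = 2 * Real.pi := Real.sq_sqrt (by positivity)
  rw [minCurvature, normalDensity_eq, normalDensity_eq, zero_pow two_ne_zero, neg_zero, zero_div,
    Real.exp_zero]
  field_simp
  rw [hsqrt]

lemma exp_le_minCurvature_mul (M : ℝ) :
    Real.exp (M + 1 / 2) ≤ minCurvature M * (2 * Real.pi * Real.exp 13 * Real.exp (M ^ 2)) :=
  calc Real.exp (M + 1 / 2) ≤ Real.exp (-((M + 3) ^ 2) / 2 + 13 + M ^ 2) :=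
        Real.exp_le_exp.2 (by nlinarith [sq_nonneg (M - 4)])
    _ = minCurvature M * (2 * Real.pi) * Real.exp 13 * Real.exp (M ^ 2) := by
        rw [minCurvature_mul_two_pi, Real.exp_add, Real.exp_add]
    _ = _ := by ring

lemma exists_pow_four_eq {a x : ℝ} (hx : a ^ 4 ≤ x) : ∃ y, a ≤ y ∧ y ^ 4 = x := by
  have hx0 : 0 ≤ x := le_trans (by positivity) hx
  refine ⟨√(√x), Real.le_sqrt_of_sq_le (Real.le_sqrt_of_sq_le ?_), ?_⟩
  · rwa [← pow_mul]
  · rw [show 4 = 2 * 2 from rfl, pow_mul, Real.sq_sqrt (Real.sqrt_nonneg x), Real.sq_sqrt hx0]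

lemma log_le_sqrt {l : ℝ} (hl : 256 ≤ l) : Real.log l ≤ √l := by
  obtain ⟨y, hy, rfl⟩ := exists_pow_four_eq (a := 4) (by linarith)
  refine Real.le_sqrt_of_sq_le ?_
  have hlog : Real.log y ≤ y := Real.log_le_self (by linarith)
  have hlog0 : 0 ≤ Real.log y := Real.log_nonneg (by linarith)
  rw [Real.log_pow]
  push_cast
  calc (4 * Real.log y) ^ 2 ≤ (y * y) ^ 2 := by gcongr
    _ = y ^ 4 := by ring

lemma sq_le_of_sqrt_div_mul_le {l x : ℝ} (hl : 256 ≤ l) (hlx : l ≤ x)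
    (h : √(l / x) * (l / Real.log x) ≤ 1 / 2) : l ^ 2 ≤ x := by
  contrapose! h
  have hl0 : 0 < l := by linarith
  have hx0 : 0 < x := by linarith
  have hlogx0 : 0 < Real.log x := Real.log_pos (by linarith)
  have hlogx : Real.log x ≤ 2 * √l :=
    calc Real.log x ≤ Real.log (l ^ 2) := Real.log_le_log hx0 h.le
      _ = 2 * Real.log l := by rw [Real.log_pow, Nat.cast_ofNat]
      _ ≤ 2 * √l := by gcongr; exact log_le_sqrt hl
  have hinv : (√l)⁻¹ < √(l / x) := by
    rw [← Real.sqrt_inv]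
    refine Real.sqrt_lt_sqrt (by positivity) ?_
    rwa [lt_div_iff₀ hx0, inv_mul_lt_iff₀ hl0, ← sq]
  calc 1 / 2 = (√l)⁻¹ * (l / (2 * √l)) := by
        field_simp
        rw [Real.sq_sqrt hl0.le]
    _ < √(l / x) * (l / (2 * √l)) := by gcongr
    _ ≤ _ := by gcongr

lemma exp_le_pow_of_le {l x : ℝ} {k : ℕ} (hl : 4096 ≤ l) (hx : l ^ 2 ≤ x)
    (hk : 4 * (l / Real.log x) ≤ k) : Real.exp l ≤ (x / (64 * l)) ^ k := by
  obtain ⟨y, hy, rfl⟩ := exists_pow_four_eq (a := 64) (x := x) (by nlinarith)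
  have hlog : 0 < Real.log y := Real.log_pos (by linarith)
  have hly : l ≤ y ^ 2 := le_of_sq_le_sq (by rwa [← pow_mul]) (by positivity)
  have hy_le : y ≤ y ^ 4 / (64 * l) := by
    rw [le_div_iff₀ (by linarith)]
    calc y * (64 * l) ≤ y * (y * y ^ 2) := by gcongr
      _ = y ^ 4 := by ring
  have hlk : l ≤ k * Real.log y := by
    rw [Real.log_pow, Nat.cast_ofNat] at hk
    field_simp at hk
    linarith
  calc Real.exp l ≤ Real.exp (k * Real.log y) := Real.exp_le_exp.2 hlk
    _ = y ^ k := by rw [Real.exp_nat_mul, Real.exp_log (by linarith)]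
    _ ≤ _ := by gcongr

/-- The constant of the finite-sample error bound. It is chosen so large that one step of the
expansion argument, of size `errorConst T * exp (M ^ 2) * sqrt (log n / (n p))`, absorbs the score
vector; see `scoreBound_lt`. -/
def errorConst (T : ℕ) : ℝ := 16 * T * (2 * T + 4) * (2 * Real.pi * Real.exp 13)

variable {T n : ℕ}

lemma errorConst_pos [NeZero T] : 0 < errorConst T := by
  have : (0 : ℝ) < T := by exact_mod_cast NeZero.pos T
  unfold errorConst
  positivity

lemma scoreBound_lt [NeZero T] {p : ℝ} (hlog : 0 < Real.log n) (hx : 0 < n * p) (M : ℝ) :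
    scoreBound T n p M <
      minCurvature M * (errorConst T * Real.exp (M ^ 2) * √(Real.log n / (n * p))) *
        (n * p / 8) := by
  have hT : (0 : ℝ) < T := by exact_mod_cast NeZero.pos T
  have hsqrt : √(Real.log n / (n * p)) * (n * p) = √(Real.log n * (n * p)) := by
    rw [Real.sqrt_div hlog.le, Real.sqrt_mul hlog.le, div_mul_eq_mul_div, mul_div_assoc,
      Real.div_sqrt]
  calc scoreBound T n p M < 2 * scoreBound T n p M :=
        lt_two_mul_self (by unfold scoreBound; positivity)
    _ ≤ 2 * ((2 * T + 4) * (T * (minCurvature M * (2 * Real.pi * Real.exp 13 *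
          Real.exp (M ^ 2)))) * √(Real.log n * (n * p))) := by
        unfold scoreBound
        gcongr
        exact exp_le_minCurvature_mul M
    _ = _ := by
        rw [errorConst, ← hsqrt]
        ring

lemma one_le_log_div_log {p : ℝ} (hp : p ≤ 1) (hx : 1 < n * p) :
    1 ≤ Real.log n / Real.log (n * p) :=
  (one_le_div (Real.log_pos hx)).2 <|
    Real.log_le_log (by linarith) (mul_le_of_le_one_right n.cast_nonneg hp)

lemma sqrt_le_sparsityRate {p : ℝ} (hp : p ≤ 1) (hx : 1 < n * p) :
    √(Real.log n / (n * p)) ≤ sparsityRate n p :=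
  le_mul_of_one_le_right (Real.sqrt_nonneg _) (one_le_log_div_log hp hx)

lemma exp_sq_mul_sparsityRate_le {p M : ℝ} (hM : 0 ≤ M) (h : 0 ≤ sparsityRate n p) :
    Real.exp (M ^ 2) * sparsityRate n p ≤ Real.exp 1 * (tmRate n p M + sparsityRate n p) :=
  calc _ ≤ Real.exp 1 * (M * Real.exp (M ^ 2) + 1) * sparsityRate n p :=
        mul_le_mul_of_nonneg_right (exp_sq_le hM) h
    _ = _ := by
        rw [tmRate]
        ring

variable [NeZero T] {Ω : Type*} [MeasurableSpace Ω] {μ : Measure Ω} [IsProbabilityMeasure μ]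
  {p : unitInterval} {u : Fin n → ℝ} {N : Pair n → Ω → ℕ} {X : Pair n → Fin T → Ω → ℤ}

lemma IsTMData.measureReal_not_mleUniqueWithin_sparsityRate_le (h : IsTMData μ T p u N X)
    (hu : FirstZero u) (hlog : 4096 ≤ Real.log n) (hnp : Real.log n ≤ n * p)
    (hrate : sparsityRate n p ≤ 1 / 2)
    (hsmall : errorConst T * Real.exp (dynamicRange u ^ 2) * sparsityRate n p ≤ 1) :
    μ.real {ω | ¬ MLEUniqueWithin (fun e => N e ω) (fun e t => X e t ω) u
      (10 * (errorConst T * Real.exp (dynamicRange u ^ 2) * sparsityRate n p))} ≤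
        14 / (n : ℝ) ^ 2 := by
  have hn : 1 < n := by
    by_contra! hn
    interval_cases n <;> norm_num at hlog
  have hx : 1 < n * (p : ℝ) := by linarith
  have hC : 0 < errorConst T := errorConst_pos
  have hratio := one_le_log_div_log p.2.2 hx
  set b := errorConst T * Real.exp (dynamicRange u ^ 2) * √(Real.log n / (n * p)) with hb
  have hb1 : b ≤ 1 := hsmall.trans' <| by
    rw [hb]
    gcongr
    exact sqrt_le_sparsityRate p.2.2 hx
  set k := ⌈4 * (Real.log n / Real.log (n * p))⌉₊
  have hk : (k : ℝ) ≤ 5 * (Real.log n / Real.log (n * p)) := by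
    linarith [Nat.ceil_lt_add_one (a := 4 * (Real.log n / Real.log (n * p))) (by positivity)]
  have hgrowth : (n : ℝ) < 2 * (n * p / (64 * Real.log n)) ^ k := by
    have hn0 : (0 : ℝ) < n := by positivity
    have := exp_le_pow_of_le (k := k) hlog (sq_le_of_sqrt_div_mul_le (by linarith) hnp hrate)
      (Nat.le_ceil _)
    rw [Real.exp_log hn0] at this
    linarith
  have hradius : 2 * k * b ≤
      10 * (errorConst T * Real.exp (dynamicRange u ^ 2) * sparsityRate n p) :=
    calc 2 * k * b ≤ 2 * (5 * (Real.log n / Real.log (n * p))) * b := by gcongr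
      _ = _ := by
        rw [hb, sparsityRate]
        ring
  refine (measureReal_mono fun ω => ?_).trans <|
    h.measureReal_not_mleUniqueWithin_le hu hn hnp hgrowth (by positivity) hb1
      (scoreBound_lt (by linarith) (by linarith) _)
  exact mt fun hwithin => hwithin.mono hradius

end Rates

/-! ### Consistency -/

section Consistency

variable {Ω : Type*} [MeasurableSpace Ω] {μ : Measure Ω} [IsProbabilityMeasure μ]

lemma ofReal_one_sub_le_measure {P : Ω → Prop} {r : ℝ} (h : μ.real {ω | ¬ P ω} ≤ r) :
    ENNReal.ofReal (1 - r) ≤ μ {ω | P ω} := by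
  have hunion : 1 ≤ μ.real {ω | P ω} + μ.real {ω | ¬ P ω} := by
    rw [← probReal_univ (μ := μ), ← Set.union_compl_self {ω | P ω}]
    exact measureReal_union_le _ _
  refine ENNReal.ofReal_le_of_le_toReal ?_
  rw [← measureReal_def]
  linarith

lemma ae_eventually_of_measureReal_not_le {P : ℕ → Ω → Prop} {f : ℕ → ℝ} (hf : Summable f)
    (h : ∀ᶠ n in atTop, μ.real {ω | ¬ P n ω} ≤ f n) : ∀ᵐ ω ∂μ, ∀ᶠ n in atTop, P n ω := by
  obtain ⟨n₀, hn₀⟩ := eventually_atTop.1 h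
  have hle (n : ℕ) : μ {ω | ¬ P (n + n₀) ω} ≤ ENNReal.ofReal (f (n + n₀)) :=
    (ENNReal.le_ofReal_iff_toReal_le (measure_ne_top _ _)
      (measureReal_nonneg.trans (hn₀ _ (n₀.le_add_left n)))).2 (hn₀ _ (n₀.le_add_left n))
  have hsum : ∑' n, μ {ω | ¬ P (n + n₀) ω} ≠ ⊤ :=
    ne_top_of_le_ne_top ((summable_nat_add_iff n₀).2 hf).tsum_ofReal_ne_top
      (ENNReal.tsum_le_tsum hle)
  filter_upwards [ae_eventually_notMem hsum] with ω hω
  rw [← map_add_atTop_eq_nat n₀, eventually_map]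
  exact hω.mono fun n => not_not.1

lemma eventually_log_le_mul {p : ℕ → ℝ} {c : ℝ} (hc : 1 < c)
    (h : ∀ᶠ n : ℕ in atTop, c * (Real.log n / n) ≤ p n) :
    ∀ᶠ n : ℕ in atTop, Real.log n ≤ n * p n := by
  filter_upwards [h, eventually_gt_atTop 0] with n hn hn0
  rw [← div_le_iff₀' (by exact_mod_cast hn0)]
  exact (le_mul_of_one_le_left (by positivity) hc.le).trans hn

lemma tendsto_norm_sub_of_mleUniqueWithin {T : ℕ} {N : (n : ℕ) → Pair n → ℕ}
    {X : (n : ℕ) → Pair n → Fin T → ℤ} {u uhat : (n : ℕ) → Fin n → ℝ} {r : ℕ → ℝ}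
    (hr : Tendsto r atTop (𝓝 0)) (h : ∀ᶠ n in atTop, MLEUniqueWithin (N n) (X n) (u n) (r n))
    (huhat : ∀ n, (∃ v, IsMLE (N n) (X n) v) → IsMLE (N n) (X n) (uhat n)) :
    Tendsto (fun n => ‖uhat n - u n‖) atTop (𝓝 0) :=
  squeeze_zero' (.of_forall fun _ => norm_nonneg _)
    (h.mono fun n hn => hn.2 _ (huhat n hn.1.exists)) hr

variable {T : ℕ} [NeZero T] {p : ℕ → unitInterval} {u : (n : ℕ) → Fin n → ℝ}
  {N : (n : ℕ) → Pair n → Ω → ℕ} {X : (n : ℕ) → Pair n → Fin T → Ω → ℤ}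

lemma eventually_measureReal_not_mleUniqueWithin_le (hu : ∀ n, FirstZero (u n))
    (hdata : ∀ n, IsTMData μ T (p n) (u n) (N n) (X n))
    (hp : ∀ᶠ n : ℕ in atTop, Real.log n ≤ n * p n)
    (hrate : Tendsto (fun n : ℕ => sparsityRate n (p n)) atTop (𝓝 0))
    (hDelta : Tendsto (fun n : ℕ => tmRate n (p n) (dynamicRange (u n))) atTop (𝓝 0)) :
    ∀ᶠ n : ℕ in atTop,
      μ.real {ω | ¬ MLEUniqueWithin (fun e => N n e ω) (fun e t => X n e t ω) (u n)
        (10 * errorConst T * Real.exp 1 *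
          (tmRate n (p n) (dynamicRange (u n)) + sparsityRate n (p n)))} ≤ 14 / (n : ℝ) ^ 2 := by
  have hlog : Tendsto (fun n : ℕ => Real.log n) atTop atTop :=
    Real.tendsto_log_atTop.comp tendsto_natCast_atTop_atTop
  have hsmall := (hDelta.add hrate).const_mul (errorConst T * Real.exp 1)
  rw [add_zero, mul_zero] at hsmall
  filter_upwards [hp, hlog.eventually_ge_atTop 4096,
    hrate.eventually_le_const (by norm_num : (0 : ℝ) < 1 / 2),
    hsmall.eventually_le_const zero_lt_one] with n hpn hlogn hraten hsmalln
  have hrate0 : 0 ≤ sparsityRate n (p n) :=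
    (Real.sqrt_nonneg _).trans (sqrt_le_sparsityRate (p n).2.2 (by linarith))
  have hexp : errorConst T * Real.exp (dynamicRange (u n) ^ 2) * sparsityRate n (p n) ≤
      errorConst T * Real.exp 1 *
        (tmRate n (p n) (dynamicRange (u n)) + sparsityRate n (p n)) := by
    rw [mul_assoc, mul_assoc]
    exact mul_le_mul_of_nonneg_left
      (exp_sq_mul_sparsityRate_le (dynamicRange_nonneg _) hrate0) errorConst_pos.le
  refine (measureReal_mono fun ω => ?_).trans <|
    (hdata n).measureReal_not_mleUniqueWithin_sparsityRate_le (hu n) hlogn hpn hraten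
      (hexp.trans hsmalln)
  exact mt fun hwithin => hwithin.mono (by linarith)

end Consistency

end PairwiseComparison

end

theorem mainTheorem6 (T : ℕ) (hT : 1 ≤ T) :
    ∃ C : ℝ, 0 < C ∧
      ∀ {Ω : Type*} [MeasurableSpace Ω] (μ : Measure Ω) [IsProbabilityMeasure μ]
        (p : ℕ → unitInterval) (u : (n : ℕ) → Fin n → ℝ)
        (N : (n : ℕ) → PairwiseComparison.Pair n → Ω → ℕ)
        (X : (n : ℕ) → PairwiseComparison.Pair n → Fin T → Ω → ℤ)
        (_hu : ∀ n, PairwiseComparison.FirstZero (u n))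
        (_hdata : ∀ n, PairwiseComparison.IsTMData μ T (p n) (u n) (N n) (X n))
        (_hp : ∃ c : ℝ, 1 < c ∧ ∀ᶠ n : ℕ in atTop, c * (Real.log n / n) ≤ (p n : ℝ))
        (_hrate : Tendsto (fun n : ℕ => PairwiseComparison.sparsityRate n (p n)) atTop (𝓝 0))
        (_hDelta : Tendsto (fun n : ℕ => PairwiseComparison.tmRate n (p n)
          (PairwiseComparison.dynamicRange (u n))) atTop (𝓝 0)),
      -- for large `n`, with probability at least `1 - 14 / n ^ 2`, the MLE uniquely exists
      -- and its sup-norm error is at most `C (Δ_n + ρ_n)`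
      (∀ᶠ n : ℕ in atTop,
        ENNReal.ofReal (1 - 14 / (n : ℝ) ^ 2) ≤
          μ {ω | PairwiseComparison.MLEUniqueWithin (fun e => N n e ω) (fun e t => X n e t ω) (u n)
            (C * (PairwiseComparison.tmRate n (p n) (PairwiseComparison.dynamicRange (u n)) +
              PairwiseComparison.sparsityRate n (p n)))}) ∧
      -- almost surely, the same holds for all but finitely many `n`
      (∀ᵐ ω ∂μ, ∀ᶠ n : ℕ in atTop,
        PairwiseComparison.MLEUniqueWithin (fun e => N n e ω) (fun e t => X n e t ω) (u n)
          (C * (PairwiseComparison.tmRate n (p n) (PairwiseComparison.dynamicRange (u n)) +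
            PairwiseComparison.sparsityRate n (p n)))) ∧
      -- the MLE is (strongly) uniformly consistent
      (∀ uhat : (n : ℕ) → Ω → Fin n → ℝ,
        (∀ n ω, (∃ v, PairwiseComparison.IsMLE (fun e => N n e ω) (fun e t => X n e t ω) v) →
          PairwiseComparison.IsMLE (fun e => N n e ω) (fun e t => X n e t ω) (uhat n ω)) →
        ∀ᵐ ω ∂μ, Tendsto (fun n : ℕ => ‖uhat n ω - u n‖) atTop (𝓝 0)) := by
  have : NeZero T := ⟨by omega⟩
  have hC : 0 < 10 * PairwiseComparison.errorConst T * Real.exp 1 := by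
    have := PairwiseComparison.errorConst_pos (T := T)
    positivity
  refine ⟨_, hC, fun μ _ p u N X hu hdata hp hrate hDelta => ?_⟩
  obtain ⟨c, hc, hp⟩ := hp
  have hprob := PairwiseComparison.eventually_measureReal_not_mleUniqueWithin_le hu hdata
    (PairwiseComparison.eventually_log_le_mul hc hp) hrate hDelta
  have hsummable : Summable fun n : ℕ => 14 / (n : ℝ) ^ 2 := by
    simpa only [mul_one_div] using (Real.summable_one_div_nat_pow.2 one_lt_two).mul_left (14 : ℝ)
  have hae := PairwiseComparison.ae_eventually_of_measureReal_not_le hsummable hprob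
  have herror := (hDelta.add hrate).const_mul (10 * PairwiseComparison.errorConst T * Real.exp 1)
  rw [add_zero, mul_zero] at herror
  refine ⟨hprob.mono fun n => PairwiseComparison.ofReal_one_sub_le_measure, hae,
    fun uhat huhat => ?_⟩
  filter_upwards [hae] with ω hω
  exact PairwiseComparison.tendsto_norm_sub_of_mleUniqueWithin herror hω fun n => huhat n ω
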